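/- **Setting.** Let $n,m,q$ be natural numbers, $x_0\in\mathbb R^n$, and let $U\subset\mathbb R^m$ be bounded and convex. Let $f(\cdot,\cdot,\cdot,e_i):\mathbb R\times\mathbb R^n\times\mathbb R^m\to\mathbb R^n$, $i=1,\dots,q$, be vector fields such that, for some $L>0$, every $f(\cdot,\cdot,\cdot,e_i)$ is differentiable in $x$ and in $u$ at the points of $[0,1]\times\mathbb R^n\times U$, and $f(\cdot,\cdot,\cdot,e_i)$, $\partial f/\partial x$ and $\partial f/\partial u$ satisfy there $$\|g(t_1,x_1,u_1)-g(t_2,x_2,u_2)\|\le L\,(|t_1-t_2|+\|x_1-x_2\|_2+\|u_1-u_2\|_2),$$ where $\|\cdot\|$ is the Euclidean norm for $g=f(\cdot,\cdot,\cdot,e_i)$ and the induced operator norm for the derivatives. Put $f(t,x,u,d)=\sum_{i=1}^q d_i f(t,x,u,e_i)$ for $d\in\mathbb R^q$. For $c:[0,1]\to\mathbb R^k$ let $\|c\|_{BV}=\sup\sum_j\|c(t_{j+1})-c(t_j)\|_1$ be its total variation, the supremum being over all finite partitions of $[0,1]$. Let $\mathcal X_r$ be the set of the relaxed inputs $\xi=(u,d)$,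 where $u:[0,1]\to U$ and $d:[0,1]\to\{d\in[0,1]^q:\sum_i d_i=1\}$ are square integrable and of bounded variation, and let $\|\xi\|_{BV}=\|u\|_{BV}+\|d\|_{BV}$. For an input $\xi=(u,d)$ let $\phi_t(\xi)=x(t)$, $t\in[0,1]$, where $x$ is the (Carathéodory) solution of $$\dot x(t)=f(t,x(t),u(t),d(t)),\qquad x(0)=x_0,$$ that is, $x(t)=x_0+\int_0^t f(s,x(s),u(s),d(s))\,ds$ for all $t\in[0,1]$, with an integrable integrand. **The projection.** Let $\lambda=1$ on $[0,\frac12)$, $\lambda=-1$ on $[\frac12,1)$ and $\lambda=0$ elsewhere, let $b_{kj}(t)=\lambda(2^kt-j)$, and for $N\in\mathbb N$ and $c:[0,1]\to\mathbb R$ let $$[\mathcal F_N(c)](t)=\langle c,1\rangle+\sum_{k=0}^N\sum_{j=0}^{2^k-1}\langle c,b_{kj}\rangle\frac{b_{kj}(t)}{\|b_{kj}\|_{L^2}^2}$$ with the inner product of $L^2([0,1],\mathbb R)$; $\mathcal F_N$ is applied to vector-valued functions coordinate by coordinate. The pulse-width modulation $[\mathcal P_N(d)]_i(t)$ equals $1$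 if $$t\in\Bigl[2^{-N}\bigl(k+\textstyle\sum_{j=1}^{i-1}d_j(k2^{-N})\bigr),\;2^{-N}\bigl(k+\textstyle\sum_{j=1}^{i}d_j(k2^{-N})\bigr)\Bigr)$$ for some $k\in\{0,\dots,2^N-1\}$, and $0$ otherwise. Put $\rho_N(u,d)=\bigl(\mathcal F_N(u),\mathcal P_N(\mathcal F_N(d))\bigr)$. **Theorem.** There is a constant $K>0$ such that, for every $\xi\in\mathcal X_r$ and every $N\in\mathbb N$ (including $N=0$), the differential equation has exactly one solution on $[0,1]$ for the input $\xi$ and exactly one for the input $\rho_N(\xi)$, and for every $t\in[0,1]$ $$\|\phi_t(\rho_N(\xi))-\phi_t(\xi)\|_2\le K\Bigl(\frac1{\sqrt2}\Bigr)^N\bigl(\|\xi\|_{BV}+1\bigr).$$ -/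

import Mathlib

open Set MeasureTheory
open scoped ENNReal

namespace SwitchedSystem

/-- `ℝᵏ` with the Euclidean norm. -/
abbrev Vec (k : ℕ) : Type := EuclideanSpace ℝ (Fin k)

/-! ### Function spaces on `[0,1]`

Functions on `[0,1]` are represented by functions on `ℝ` of which only the values on `[0,1]`
are used. -/

/-- The total variation on `[0,1]`, increments being measured in the `1`-norm. -/
noncomputable def totalVariation {k : ℕ} (c : ℝ → Vec k) : ℝ≥0∞ :=
  eVariationOn (fun t => WithLp.toLp 1 (WithLp.ofLp (c t)) : ℝ → PiLp 1 (fun _ : Fin k => ℝ))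
    (Icc 0 1)

/-- `L²([0,1], Y) ∩ BV([0,1], Y)`. -/
def L2BV {k : ℕ} (Y : Set (Vec k)) : Set (ℝ → Vec k) :=
  {c | (∀ t ∈ Icc (0 : ℝ) 1, c t ∈ Y) ∧
    MemLp c 2 (volume.restrict (Icc (0 : ℝ) 1)) ∧ totalVariation c < ∞}

/-- The `q`-simplex. -/
def simplex (q : ℕ) : Set (Vec q) :=
  {d | (∀ i, d i ∈ Icc (0 : ℝ) 1) ∧ ∑ i, d i = 1}

/-- A pair `(u, d)` of a continuous-valued input and a discrete input. -/
abbrev Input (m q : ℕ) : Type := (ℝ → Vec m) × (ℝ → Vec q)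

/-- The relaxed optimization space: `u` takes values in `U`, and `d` in the simplex. -/
def relaxedSpace {m : ℕ} (U : Set (Vec m)) (q : ℕ) : Set (Input m q) :=
  L2BV U ×ˢ L2BV (simplex q)

/-- The total variation of `ξ = (u, d)`. As increments are measured in the `1`-norm, the
variation of the pair is the sum of the variations of `u` and of `d`. -/
noncomputable def bvNorm {m q : ℕ} (ξ : Input m q) : ℝ :=
  (totalVariation ξ.1 + totalVariation ξ.2).toReal

/-! ### Dynamics -/

/-- A switched system: `f t x u i` is the value of the `i`-th vector field at `(t, x, u)`. -/
abbrev VectorFields (n m q : ℕ) : Type := ℝ → Vec n → Vec m → Fin q → Vec n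

/-- Each mode is differentiable in `x` and in `u`, and the mode and its two partial derivatives
are Lipschitz in `(t, x, u)` on `[0,1] × ℝⁿ × U` with constant `L > 0`. -/
structure Regular {n m q : ℕ} (f : VectorFields n m q) (U : Set (Vec m)) (L : ℝ) : Prop where
  pos : 0 < L
  differentiable_x : ∀ i, ∀ t ∈ Icc (0 : ℝ) 1, ∀ x, ∀ u ∈ U,
    DifferentiableAt ℝ (fun y => f t y u i) x
  differentiable_u : ∀ i, ∀ t ∈ Icc (0 : ℝ) 1, ∀ x, ∀ u ∈ U,
    DifferentiableAt ℝ (fun v => f t x v i) u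
  lipschitz : ∀ i, ∀ t₁ ∈ Icc (0 : ℝ) 1, ∀ t₂ ∈ Icc (0 : ℝ) 1, ∀ x₁ x₂, ∀ u₁ ∈ U, ∀ u₂ ∈ U,
    ‖f t₁ x₁ u₁ i - f t₂ x₂ u₂ i‖ ≤ L * (|t₁ - t₂| + ‖x₁ - x₂‖ + ‖u₁ - u₂‖)
  lipschitz_dx : ∀ i, ∀ t₁ ∈ Icc (0 : ℝ) 1, ∀ t₂ ∈ Icc (0 : ℝ) 1, ∀ x₁ x₂,
    ∀ u₁ ∈ U, ∀ u₂ ∈ U,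
    ‖fderiv ℝ (fun y => f t₁ y u₁ i) x₁ - fderiv ℝ (fun y => f t₂ y u₂ i) x₂‖ ≤
      L * (|t₁ - t₂| + ‖x₁ - x₂‖ + ‖u₁ - u₂‖)
  lipschitz_du : ∀ i, ∀ t₁ ∈ Icc (0 : ℝ) 1, ∀ t₂ ∈ Icc (0 : ℝ) 1, ∀ x₁ x₂,
    ∀ u₁ ∈ U, ∀ u₂ ∈ U,
    ‖fderiv ℝ (fun v => f t₁ x₁ v i) u₁ - fderiv ℝ (fun v => f t₂ x₂ v i) u₂‖ ≤
      L * (|t₁ - t₂| + ‖x₁ - x₂‖ + ‖u₁ - u₂‖)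

/-- The vector field at a relaxed discrete value: `f(t, x, u, d) = ∑ᵢ dᵢ f(t, x, u, eᵢ)`. -/
noncomputable def relaxedField {n m q : ℕ} (f : VectorFields n m q)
    (t : ℝ) (x : Vec n) (u : Vec m) (d : Vec q) : Vec n :=
  ∑ i, d i • f t x u i

/-- `x` is on `[0,1]` a (Carathéodory) solution of `x' = f(t, x, u, d)`, `x(0) = x₀`. As the
inputs may be discontinuous, the differential equation is understood in integrated form. -/
def IsTrajectory {n m q : ℕ} (f : VectorFields n m q) (x₀ : Vec n) (ξ : Input m q)
    (x : ℝ → Vec n) : Prop :=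
  IntervalIntegrable (fun s => relaxedField f s (x s) (ξ.1 s) (ξ.2 s)) volume 0 1 ∧
  ∀ t ∈ Icc (0 : ℝ) 1, x t = x₀ + ∫ s in (0 : ℝ)..t, relaxedField f s (x s) (ξ.1 s) (ξ.2 s)

/-- The differential equation has exactly one solution on `[0,1]`. -/
def HasUniqueTrajectory {n m q : ℕ} (f : VectorFields n m q) (x₀ : Vec n) (ξ : Input m q) :
    Prop :=
  ∃ x, IsTrajectory f x₀ ξ x ∧ ∀ y, IsTrajectory f x₀ ξ y → EqOn y x (Icc 0 1)

open Classical in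
/-- The flow `φ_t(ξ)`: the value at time `t` of the trajectory corresponding to `ξ`
(and `0` if there is no trajectory). -/
noncomputable def flow {n m q : ℕ} (f : VectorFields n m q) (x₀ : Vec n) (t : ℝ)
    (ξ : Input m q) : Vec n :=
  if h : ∃ x, IsTrajectory f x₀ ξ x then h.choose t else 0

/-! ### The projection -/

/-- The Haar wavelet. -/
noncomputable def haar (t : ℝ) : ℝ :=
  if t ∈ Ico (0 : ℝ) (1 / 2) then 1 else if t ∈ Ico (1 / 2 : ℝ) 1 then -1 else 0

/-- `b_{kj}(t) = λ(2ᵏ t - j)`. -/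
noncomputable def haarBasis (k j : ℕ) (t : ℝ) : ℝ := haar (2 ^ k * t - j)

/-- The inner product of `L²([0,1], ℝ)`. -/
noncomputable def innerL2 (c b : ℝ → ℝ) : ℝ := ∫ t in (0 : ℝ)..1, c t * b t

/-- `𝓕_N(c)`: the Haar wavelet expansion of `c`, truncated after level `N`. -/
noncomputable def haarTrunc (N : ℕ) (c : ℝ → ℝ) (t : ℝ) : ℝ :=
  innerL2 c (fun _ => 1) + ∑ k ∈ Finset.range (N + 1), ∑ j ∈ Finset.range (2 ^ k),
    innerL2 c (haarBasis k j) * (haarBasis k j t / innerL2 (haarBasis k j) (haarBasis k j))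

/-- `𝓕_N` applied to each coordinate. -/
noncomputable def haarTruncVec {k : ℕ} (N : ℕ) (c : ℝ → Vec k) (t : ℝ) : Vec k :=
  WithLp.toLp 2 fun i => haarTrunc N (fun s => c s i) t

open Classical in
/-- `𝓟_N(d)`: pulse-width modulation at frequency `2⁻ᴺ`. -/
noncomputable def pwm {q : ℕ} (N : ℕ) (d : ℝ → Vec q) (t : ℝ) : Vec q :=
  WithLp.toLp 2 fun i =>
    if ∃ k < 2 ^ N, t ∈ Ico
        (((k : ℕ) + ∑ j ∈ Finset.Iio i, d ((k : ℝ) / 2 ^ N) j) / 2 ^ N : ℝ)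
        (((k : ℕ) + ∑ j ∈ Finset.Iic i, d ((k : ℝ) / 2 ^ N) j) / 2 ^ N : ℝ)
    then 1 else 0

/-- `ρ_N(u, d) = (𝓕_N(u), 𝓟_N(𝓕_N(d)))`. -/
noncomputable def rho {m q : ℕ} (N : ℕ) (ξ : Input m q) : Input m q :=
  (haarTruncVec N ξ.1, pwm N (haarTruncVec N ξ.2))

end SwitchedSystem

open SwitchedSystem

/-! The error is in fact of order `2⁻ᴺ`, and the stated rate follows from it. Divide `[0,1]` into
`2ᴺ` cells of length `2⁻ᴺ`. The Haar truncation replaces a function by its averages over half cells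
(`haarTruncVec_eq_average`). On a cell it therefore stays in every convex set that contains the
values of the function there: in `U`, in the simplex, and in a ball whose radius is the variation on
the cell. Pulse-width modulation moves the discrete input by an amount of order one, but over a
whole cell it has the same integral as the sample that it encodes (`integral_pwm`).

On each cell, freeze time, state and `u` at the left endpoint. The freezing costs at most a
Lipschitz constant times the cell length plus the variation. What remains is linear in the
difference of the discrete inputs, so only the integral of that difference matters
(`Regular.norm_integral_relaxedField_sub_le`). Each cell thus contributes `2⁻ᴺ` times its length
plus its variation. The sum is `O(2⁻ᴺ (1 + BV))`, an incomplete last cell costing `O(2⁻ᴺ)` more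
(`norm_integral_le_of_dyadic`).

This bounds the defect of the original trajectory in the projected equation, and Grönwall's
inequality turns it into a bound on the distance of the trajectories. Existence and uniqueness come
from Carathéodory theory, which applies because the truncated `u` remains in `U`, closed or not
(`integral_mem_of_convex`). -/

namespace SwitchedSystem

/-! ### Grönwall's inequality and Carathéodory equations on `[0,1]` -/

theorem le_mul_exp_of_le_add_integral {v : ℝ → ℝ} {a L : ℝ} (hL : 0 ≤ L)
    (hv : ContinuousOn v (Icc 0 1))
    (h : ∀ t ∈ Icc (0 : ℝ) 1, v t ≤ a + L * ∫ s in (0 : ℝ)..t, v s) :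
    ∀ t ∈ Icc (0 : ℝ) 1, v t ≤ a * Real.exp (L * t) := by
  set w : ℝ → ℝ := IccExtend (zero_le_one' ℝ) ((Icc (0 : ℝ) 1).domRestrict v) with hw
  have hwc : Continuous w := (continuousOn_iff_continuous_domRestrict.1 hv).Icc_extend'
  have hwv : ∀ t ∈ Icc (0 : ℝ) 1, w t = v t := fun t ht => by
    rw [hw, IccExtend_of_mem _ _ ht]; rfl
  have hint : ∀ t ∈ Icc (0 : ℝ) 1, ∫ s in (0 : ℝ)..t, v s = ∫ s in (0 : ℝ)..t, w s := by
    intro t ht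
    refine intervalIntegral.integral_congr fun s hs => (hwv s ?_).symm
    rw [uIcc_of_le ht.1] at hs
    exact ⟨hs.1, hs.2.trans ht.2⟩
  have hder : ∀ t, HasDerivAt (fun t => a + L * ∫ s in (0 : ℝ)..t, w s) (L * w t) t := fun t =>
    ((intervalIntegral.integral_hasDerivAt_right (hwc.intervalIntegrable _ _)
      hwc.aestronglyMeasurable.stronglyMeasurableAtFilter hwc.continuousAt).const_mul L).const_add a
  -- The differential Grönwall inequality is applied to the majorant `a + L ∫ v`, which is
  -- differentiable although `v` need not be.
  have key := le_gronwallBound_of_liminf_deriv_right_le (a := 0) (b := 1)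
    (f := fun t => a + L * ∫ s in (0 : ℝ)..t, w s) (f' := fun t => L * w t) (δ := a) (K := L)
    (ε := 0) (fun t _ => (hder t).continuousAt.continuousWithinAt)
    (fun t _ r hr => (hder t).hasDerivWithinAt.liminf_right_slope_le hr) (by simp)
    (fun t ht => by
      have ht' := Ico_subset_Icc_self ht
      have := h t ht'
      rw [hint t ht', ← hwv t ht'] at this
      simpa using mul_le_mul_of_nonneg_left this hL)
  intro t ht
  have h1 := key t ht
  rw [gronwallBound_ε0, sub_zero] at h1
  have h2 := h t ht
  rw [hint t ht] at h2
  exact h2.trans h1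

/-- The dyadic cells are half-open and leave out `t = 1`, so pointwise conditions on the inputs are
imposed on `[0,1)` only. -/
theorem ae_restrict_mem_Ico : ∀ᵐ s ∂(volume.restrict (Icc (0 : ℝ) 1)), s ∈ Ico (0 : ℝ) 1 := by
  rw [restrict_Ico_eq_restrict_Icc.symm]
  exact ae_restrict_mem measurableSet_Ico

section Caratheodory

variable {E : Type*} [NormedAddCommGroup E]

/-- The right-hand side `G` of a differential equation on `[0,1]` satisfies the Carathéodory
conditions: it is Lipschitz in the state, bounded at the origin, and measurable along continuous
curves. -/
structure IsCaratheodory (G : ℝ → E → E) (L C : ℝ) : Prop where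
  pos : 0 < L
  lipschitz : ∀ s ∈ Ico (0 : ℝ) 1, ∀ x y, ‖G s x - G s y‖ ≤ L * ‖x - y‖
  bound : ∀ s ∈ Ico (0 : ℝ) 1, ‖G s 0‖ ≤ C
  measurable : ∀ x : ℝ → E, Continuous x →
    AEStronglyMeasurable (fun s => G s (x s)) (volume.restrict (Icc (0 : ℝ) 1))

variable {G : ℝ → E → E} {L C : ℝ}

theorem IsCaratheodory.norm_le (hG : IsCaratheodory G L C) {s : ℝ} (hs : s ∈ Ico (0 : ℝ) 1)
    (x : E) : ‖G s x‖ ≤ L * ‖x‖ + C := by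
  have h1 := hG.lipschitz s hs x 0
  rw [sub_zero] at h1
  have h2 := norm_add_le (G s x - G s 0) (G s 0)
  rw [sub_add_cancel] at h2
  linarith [hG.bound s hs]

theorem IsCaratheodory.integrableOn (hG : IsCaratheodory G L C) {x : ℝ → E}
    (hx : ContinuousOn x (Icc 0 1)) : IntegrableOn (fun s => G s (x s)) (Icc 0 1) := by
  obtain ⟨R, hR⟩ := isCompact_Icc.exists_bound_of_continuousOn hx
  set w : ℝ → E := IccExtend (zero_le_one' ℝ) ((Icc (0 : ℝ) 1).domRestrict x) with hw
  have hwc : Continuous w := (continuousOn_iff_continuous_domRestrict.1 hx).Icc_extend'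
  have hwx : ∀ t ∈ Icc (0 : ℝ) 1, w t = x t := fun t ht => by
    rw [hw, IccExtend_of_mem _ _ ht]; rfl
  have hm : AEStronglyMeasurable (fun s => G s (x s)) (volume.restrict (Icc (0 : ℝ) 1)) :=
    (hG.measurable w hwc).congr <| by
      filter_upwards [ae_restrict_mem measurableSet_Icc] with s hs
      rw [hwx s hs]
  refine Integrable.of_bound hm (L * R + C) ?_
  filter_upwards [ae_restrict_mem_Ico] with s hs
  have := mul_le_mul_of_nonneg_left (hR s (Ico_subset_Icc_self hs)) hG.pos.le
  linarith [hG.norm_le hs (x s)]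

theorem intervalIntegrable_of_integrableOn_Icc {g : ℝ → E} (hg : IntegrableOn g (Icc 0 1))
    {a b : ℝ} (ha : a ∈ Icc (0 : ℝ) 1) (hb : b ∈ Icc (0 : ℝ) 1) :
    IntervalIntegrable g volume a b :=
  (hg.mono_set (uIcc_subset_Icc ha hb)).intervalIntegrable

variable [NormedSpace ℝ E]

theorem norm_integral_le_of_norm_le_Ico {g : ℝ → E} {b : ℝ → ℝ} {s t : ℝ} (hst : s ≤ t)
    (hb : IntervalIntegrable b volume s t)
    (h : ∀ r ∈ Ico s t, ‖g r‖ ≤ b r) :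
    ‖∫ r in s..t, g r‖ ≤ ∫ r in s..t, b r := by
  refine intervalIntegral.norm_integral_le_of_norm_le hst ?_ hb
  have : ∀ᵐ r ∂(volume : Measure ℝ), r ≠ t := by simp [ae_iff]
  filter_upwards [this] with r hr hr'
  exact h r ⟨hr'.1.le, lt_of_le_of_ne hr'.2 hr⟩

theorem continuousOn_of_eq_add_integral {g : ℝ → E} {x : ℝ → E} {x₀ : E}
    (hg : IntegrableOn g (Icc 0 1))
    (hx : ∀ t ∈ Icc (0 : ℝ) 1, x t = x₀ + ∫ s in (0 : ℝ)..t, g s) :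
    ContinuousOn x (Icc 0 1) := by
  have h1 := intervalIntegral.continuousOn_primitive_interval (a := 0) (b := 1) (f := g)
    (μ := volume) (by rwa [uIcc_of_le zero_le_one])
  rw [uIcc_of_le zero_le_one] at h1
  exact (continuousOn_const.add h1).congr hx

theorem integral_exp_le (L t : ℝ) :
    Real.exp (-(2 * L * t)) * (∫ s in (0 : ℝ)..t, L * Real.exp (2 * L * s)) ≤ 1 / 2 := by
  have h : ∫ s in (0 : ℝ)..t, L * Real.exp (2 * L * s) = (Real.exp (2 * L * t) - 1) / 2 := by
    have hd : ∀ s ∈ uIcc 0 t,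
        HasDerivAt (fun s => Real.exp (2 * L * s) / 2) (L * Real.exp (2 * L * s)) s := by
      intro s _
      have h : HasDerivAt (fun s => Real.exp (2 * L * s) / 2)
          (Real.exp (2 * L * s) * (2 * L * 1) / 2) s :=
        (((hasDerivAt_id s).const_mul (2 * L)).exp).div_const 2
      exact h.congr_deriv (by ring)
    rw [intervalIntegral.integral_eq_sub_of_hasDerivAt hd
      (Continuous.intervalIntegrable (by fun_prop) _ _)]
    simp; ring
  rw [h, Real.exp_neg]
  have := Real.exp_pos (2 * L * t)
  rw [inv_mul_le_iff₀ this]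
  linarith

/-- Picard iteration in the unknown `z(t) = exp(-2Lt) x(t)`. The sup norm of `z` is a weighted norm
of `x` for which the integral map contracts by `1/2` on all of `[0,1]`, however large `L` is. -/
theorem IsCaratheodory.exists_solution [CompleteSpace E] (hG : IsCaratheodory G L C) (x₀ : E) :
    ∃ x : ℝ → E, ContinuousOn x (Icc 0 1) ∧
      ∀ t ∈ Icc (0 : ℝ) 1, x t = x₀ + ∫ s in (0 : ℝ)..t, G s (x s) := by
  let P : C(Icc (0 : ℝ) 1, E) → ℝ → E := fun z s =>
    Real.exp (2 * L * s) • IccExtend (zero_le_one' ℝ) z s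
  have hP : ∀ z, Continuous (P z) := fun z =>
    (by fun_prop : Continuous fun s : ℝ => Real.exp (2 * L * s)).smul z.continuous.Icc_extend'
  have hGP : ∀ z, IntegrableOn (fun s => G s (P z s)) (Icc 0 1) := fun z =>
    hG.integrableOn (hP z).continuousOn
  have hc : ∀ z, ContinuousOn (fun t : ℝ => Real.exp (-(2 * L * t)) •
      (x₀ + ∫ s in (0 : ℝ)..t, G s (P z s))) (Icc 0 1) := fun z =>
    (by fun_prop : Continuous fun s : ℝ => Real.exp (-(2 * L * s))).continuousOn.smul
      (continuousOn_of_eq_add_integral (hGP z) (fun _ _ => rfl))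
  let S : C(Icc (0 : ℝ) 1, E) → C(Icc (0 : ℝ) 1, E) := fun z =>
    ⟨_, continuousOn_iff_continuous_domRestrict.1 (hc z)⟩
  have hSapp : ∀ z (t : Icc (0 : ℝ) 1), S z t = Real.exp (-(2 * L * t)) •
      (x₀ + ∫ s in (0 : ℝ)..t, G s (P z s)) := fun z t => rfl
  have hS : ContractingWith (1 / 2 : NNReal) S := by
    refine ⟨by rw [← NNReal.coe_lt_coe]; norm_num, LipschitzWith.of_dist_le_mul fun y z => ?_⟩
    rw [ContinuousMap.dist_le (by positivity)]
    intro t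
    have h0 : (0 : ℝ) ∈ Icc (0 : ℝ) 1 := ⟨le_rfl, zero_le_one⟩
    have ht := t.2
    rw [dist_eq_norm, hSapp, hSapp, ← smul_sub, add_sub_add_left_eq_sub,
      ← intervalIntegral.integral_sub (intervalIntegrable_of_integrableOn_Icc (hGP y) h0 ht)
        (intervalIntegrable_of_integrableOn_Icc (hGP z) h0 ht), norm_smul,
      Real.norm_of_nonneg (Real.exp_pos _).le]
    have h1 : ‖∫ s in (0 : ℝ)..t, (G s (P y s) - G s (P z s))‖ ≤
        ∫ s in (0 : ℝ)..t, (L * Real.exp (2 * L * s)) * dist y z := by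
      refine norm_integral_le_of_norm_le_Ico ht.1
        (Continuous.intervalIntegrable (by fun_prop) _ _) fun s hs => ?_
      refine (hG.lipschitz s ⟨hs.1, hs.2.trans_le ht.2⟩ _ _).trans ?_
      simp only [P]
      rw [← smul_sub, norm_smul, Real.norm_of_nonneg (Real.exp_pos _).le, mul_assoc L]
      refine mul_le_mul_of_nonneg_left (mul_le_mul_of_nonneg_left ?_ (Real.exp_pos _).le) hG.pos.le
      rw [← dist_eq_norm]
      exact ContinuousMap.dist_apply_le_dist _
    rw [intervalIntegral.integral_mul_const] at h1
    calc _ ≤ Real.exp (-(2 * L * t)) *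
          ((∫ s in (0 : ℝ)..t, L * Real.exp (2 * L * s)) * dist y z) := by gcongr
      _ = (Real.exp (-(2 * L * t)) * (∫ s in (0 : ℝ)..t, L * Real.exp (2 * L * s))) * dist y z := by
          ring
      _ ≤ 1 / 2 * dist y z := by
          gcongr
          exact integral_exp_le L t
      _ = _ := by simp
  have hfix := hS.fixedPoint_isFixedPt
  set z := hS.fixedPoint S
  refine ⟨P z, (hP z).continuousOn, fun t ht => ?_⟩
  have h1 : z ⟨t, ht⟩ = Real.exp (-(2 * L * t)) • (x₀ + ∫ s in (0 : ℝ)..t, G s (P z s)) := by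
    conv_lhs => rw [← hfix.eq]
    rfl
  have h2 : P z t = Real.exp (2 * L * t) • z ⟨t, ht⟩ := by
    simp only [P]
    rw [IccExtend_of_mem _ _ ht]
  rw [h2, h1, smul_smul, ← Real.exp_add, add_neg_cancel, Real.exp_zero, one_smul]

/-- Two curves whose integral equations differ by at most `a` stay close. -/
theorem IsCaratheodory.norm_sub_le (hG : IsCaratheodory G L C) {x y : ℝ → E} {a : ℝ}
    (hx : ContinuousOn x (Icc 0 1)) (hy : ContinuousOn y (Icc 0 1))
    (h : ∀ t ∈ Icc (0 : ℝ) 1,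
      ‖y t - x t - ∫ s in (0 : ℝ)..t, (G s (y s) - G s (x s))‖ ≤ a) :
    ∀ t ∈ Icc (0 : ℝ) 1, ‖y t - x t‖ ≤ a * Real.exp L := by
  have hc : ContinuousOn (fun t => ‖y t - x t‖) (Icc 0 1) := (hy.sub hx).norm
  have ha : 0 ≤ a := (norm_nonneg _).trans (h 0 ⟨le_rfl, zero_le_one⟩)
  intro t ht
  refine (le_mul_exp_of_le_add_integral hG.pos.le hc (a := a) (fun t ht => ?_) t ht).trans ?_
  · have h1 : ‖∫ s in (0 : ℝ)..t, (G s (y s) - G s (x s))‖ ≤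
        ∫ s in (0 : ℝ)..t, L * ‖y s - x s‖ := by
      refine norm_integral_le_of_norm_le_Ico ht.1 ?_ fun s hs =>
        hG.lipschitz s ⟨hs.1, hs.2.trans_le ht.2⟩ _ _
      refine (hc.mono ?_).intervalIntegrable.const_mul L
      exact uIcc_subset_Icc ⟨le_rfl, zero_le_one⟩ ht
    rw [intervalIntegral.integral_const_mul] at h1
    have h2 := norm_sub_norm_le (y t - x t) (∫ s in (0 : ℝ)..t, (G s (y s) - G s (x s)))
    linarith [h t ht]
  · have := hG.pos
    gcongr
    nlinarith [ht.2]

theorem IsCaratheodory.norm_solution_le (hG : IsCaratheodory G L C) {x : ℝ → E} {x₀ : E}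
    (hx : ContinuousOn x (Icc 0 1))
    (h : ∀ t ∈ Icc (0 : ℝ) 1, x t = x₀ + ∫ s in (0 : ℝ)..t, G s (x s)) :
    ∀ t ∈ Icc (0 : ℝ) 1, ‖x t‖ ≤ (‖x₀‖ + C) * Real.exp L := by
  have h01 : (0 : ℝ) ∈ Icc (0 : ℝ) 1 := ⟨le_rfl, zero_le_one⟩
  have hC : 0 ≤ C := (norm_nonneg _).trans (hG.bound 0 ⟨le_rfl, zero_lt_one⟩)
  -- Compare with the zero curve: the defect is then `x₀ + ∫ G s 0`.
  have key := hG.norm_sub_le (x := fun _ => 0) (y := x) (a := ‖x₀‖ + C) continuousOn_const hx ?_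
  · simpa using key
  intro t ht
  rw [intervalIntegral.integral_sub
    (intervalIntegrable_of_integrableOn_Icc (hG.integrableOn hx) h01 ht)
    (intervalIntegrable_of_integrableOn_Icc (hG.integrableOn continuousOn_const) h01 ht)]
  have h1 : ‖∫ s in (0 : ℝ)..t, G s 0‖ ≤ C := by
    refine (norm_integral_le_of_norm_le_Ico ht.1
      (intervalIntegrable_const (c := C)) fun s hs =>
        hG.bound s ⟨hs.1, hs.2.trans_le ht.2⟩).trans ?_
    rw [intervalIntegral.integral_const, smul_eq_mul]
    nlinarith [ht.1, ht.2]
  have h2 : x t - 0 - ((∫ s in (0 : ℝ)..t, G s (x s)) - ∫ s in (0 : ℝ)..t, G s 0) =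
      x₀ + ∫ s in (0 : ℝ)..t, G s 0 := by
    rw [h t ht]; abel
  rw [h2]
  exact (norm_add_le _ _).trans (by linarith)

theorem IsCaratheodory.eqOn_of_solution (hG : IsCaratheodory G L C) {x y : ℝ → E} {x₀ : E}
    (hx : ContinuousOn x (Icc 0 1)) (hy : ContinuousOn y (Icc 0 1))
    (h : ∀ t ∈ Icc (0 : ℝ) 1, x t = x₀ + ∫ s in (0 : ℝ)..t, G s (x s))
    (h' : ∀ t ∈ Icc (0 : ℝ) 1, y t = x₀ + ∫ s in (0 : ℝ)..t, G s (y s)) :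
    EqOn y x (Icc 0 1) := by
  have h01 : (0 : ℝ) ∈ Icc (0 : ℝ) 1 := ⟨le_rfl, zero_le_one⟩
  intro t ht
  have key := hG.norm_sub_le (a := 0) hx hy (fun t ht => by
    rw [intervalIntegral.integral_sub
      (intervalIntegrable_of_integrableOn_Icc (hG.integrableOn hy) h01 ht)
      (intervalIntegrable_of_integrableOn_Icc (hG.integrableOn hx) h01 ht)]
    conv_lhs => rw [h t ht, h' t ht]
    simp) t ht
  rw [zero_mul] at key
  exact sub_eq_zero.1 (norm_le_zero_iff.1 key)

end Caratheodory

/-! ### Barycenters in convex sets that need not be closed -/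

/-- A convex set in a finite-dimensional space which does not contain the origin lies in a closed
half-space. -/
theorem exists_dual_nonneg_of_convex {E : Type*} [NormedAddCommGroup E] [NormedSpace ℝ E]
    [FiniteDimensional ℝ E] {s : Set E} (hs : Convex ℝ s) (h0 : (0 : E) ∉ s)
    (hne : s.Nonempty) :
    ∃ l : E →L[ℝ] ℝ, l ≠ 0 ∧ ((∀ x ∈ s, 0 ≤ l x) ∨ ∃ c, ∀ x ∈ s, l x = c) := by
  by_cases hi : (interior s).Nonempty
  · obtain ⟨l, hl⟩ := geometric_hahn_banach_open_point hs.interior isOpen_interior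
      (fun h => h0 (interior_subset h))
    refine ⟨-l, fun h => ?_, Or.inl fun x hx => ?_⟩
    · obtain ⟨a, ha⟩ := hi
      have := hl a ha
      rw [neg_eq_zero.1 h] at this
      simp at this
    · have hx' : x ∈ closure (interior s) := by
        rw [hs.closure_interior_eq_closure_of_nonempty_interior hi]
        exact subset_closure hx
      have : l x ≤ l 0 := closure_minimal (s := interior s) (t := {x | l x ≤ l 0})
        (fun a ha => (hl a ha).le) (isClosed_le l.continuous continuous_const) hx'
      simpa using this
  -- Without interior points `s` lies in a proper affine subspace, and a functional vanishing on its
  -- direction is constant on `s`.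
  · rw [hs.interior_nonempty_iff_affineSpan_eq_top] at hi
    obtain ⟨a, ha⟩ := hne
    have haa := subset_affineSpan ℝ s ha
    have hd : (affineSpan ℝ s).direction < ⊤ := by
      rw [lt_top_iff_ne_top]
      intro h
      exact hi ((AffineSubspace.direction_eq_top_iff_of_nonempty ⟨a, haa⟩).1 h)
    obtain ⟨l, hl, hl'⟩ := Submodule.exists_le_ker_of_lt_top _ hd
    refine ⟨l.toContinuousLinearMap, fun h => hl ?_, Or.inr ⟨l a, fun x hx => ?_⟩⟩
    · ext x
      simpa using DFunLike.congr_fun h x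
    · have : x -ᵥ a ∈ (affineSpan ℝ s).direction :=
        AffineSubspace.vsub_mem_direction (subset_affineSpan ℝ s hx) haa
      have := hl' this
      rw [LinearMap.mem_ker, vsub_eq_sub, map_sub, sub_eq_zero] at this
      exact this

/-- Induction on the dimension. If `0 ∉ s`, some `l ≠ 0` is nonnegative or constant on `s`. As `l ∘
g` has integral zero, it vanishes almost everywhere, so `g` lives in `ker l`, of smaller dimension.
The space is quantified inside the statement so that it can change in the induction. -/
theorem zero_mem_of_integral_eq_zero {α : Type*} [MeasurableSpace α] (μ : Measure α)
    [IsProbabilityMeasure μ] (r : ℕ) :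
    ∀ {E : Type*} [NormedAddCommGroup E] [NormedSpace ℝ E] [FiniteDimensional ℝ E]
      {s : Set E} {g : α → E}, Module.finrank ℝ E = r → Convex ℝ s → Integrable g μ →
      (∀ᵐ x ∂μ, g x ∈ s) → ∫ x, g x ∂μ = 0 → (0 : E) ∈ s := by
  induction r using Nat.strong_induction_on with
  | _ r ih =>
    intro E _ _ _ s g hr hs hg hgs hg0
    by_contra h0
    have hne : s.Nonempty := by
      obtain ⟨x, hx⟩ := hgs.exists
      exact ⟨_, hx⟩
    obtain ⟨l, hl0, hl⟩ := exists_dual_nonneg_of_convex hs h0 hne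
    have hint : ∫ x, l (g x) ∂μ = 0 := by
      rw [l.integral_comp_comm hg, hg0, map_zero]
    have hker : ∀ᵐ x ∂μ, g x ∈ LinearMap.ker (l : E →ₗ[ℝ] ℝ) := by
      rcases hl with hl | ⟨c, hc⟩
      · have h1 : 0 ≤ᵐ[μ] fun x => l (g x) := by
          filter_upwards [hgs] with x hx using hl _ hx
        have h2 := (integral_eq_zero_iff_of_nonneg_ae h1 (l.integrable_comp hg)).1 hint
        filter_upwards [h2] with x hx
        simpa using hx
      · have h1 : (fun x => l (g x)) =ᵐ[μ] fun _ => c := by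
          filter_upwards [hgs] with x hx using hc _ hx
        rw [integral_congr_ae h1] at hint
        have hc0 : c = 0 := by simpa using hint
        filter_upwards [h1] with x hx
        simpa [hc0] using hx
    set V : Submodule ℝ E := LinearMap.ker (l : E →ₗ[ℝ] ℝ)
    have hV : V ≠ ⊤ := fun h => hl0 (by
      ext x
      have : x ∈ V := h ▸ Submodule.mem_top
      simpa [V] using this)
    obtain ⟨p, hp⟩ := V.exists_isCompl
    -- The projection makes `g` into a function with values in `V` everywhere, changing it only on a
    -- null set, and it commutes with the integral.
    let π : E →L[ℝ] V := (V.projectionOnto p hp).toContinuousLinearMap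
    have hπ : ∀ v : V, π v = v := fun v => Submodule.projectionOnto_apply_left hp v
    have := ih (Module.finrank ℝ V) (hr ▸ Submodule.finrank_lt hV) (E := V)
      (s := V.subtype ⁻¹' s) (g := fun x => π (g x)) rfl (hs.linear_preimage V.subtype)
      (π.integrable_comp hg) ?_ ?_
    · exact h0 (by simpa using this)
    · filter_upwards [hgs, hker] with x hx hx'
      have := hπ ⟨g x, hx'⟩
      simp only at this
      rw [mem_preimage, this]
      exact hx
    · rw [π.integral_comp_comm hg, hg0, map_zero]

/-- The barycenter of a function with values in a convex subset of a finite-dimensional space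
belongs to the subset, even when it is not closed. -/
theorem integral_mem_of_convex {α : Type*} [MeasurableSpace α] {μ : Measure α}
    [IsProbabilityMeasure μ] {E : Type*} [NormedAddCommGroup E] [NormedSpace ℝ E]
    [FiniteDimensional ℝ E] {s : Set E} {g : α → E} (hs : Convex ℝ s) (hg : Integrable g μ)
    (hgs : ∀ᵐ x ∂μ, g x ∈ s) : ∫ x, g x ∂μ ∈ s := by
  have h := zero_mem_of_integral_eq_zero μ _ (s := (fun x => (∫ x, g x ∂μ) + x) ⁻¹' s)
    (g := fun x => g x - ∫ x, g x ∂μ) rfl (hs.translate_preimage_right _)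
    (hg.sub (integrable_const _)) (by
      filter_upwards [hgs] with x hx
      simpa using hx)
    (by rw [integral_sub hg (integrable_const _)]; simp)
  simpa using h

/-! ### Haar truncation -/

section IntervalHelpers

variable {E : Type*} [NormedAddCommGroup E]

theorem ae_uIoc_mem_Ico {a b : ℝ} (hab : a ≤ b) :
    ∀ᵐ s ∂(volume : Measure ℝ), s ∈ uIoc a b → s ∈ Ico a b := by
  have : ∀ᵐ s ∂(volume : Measure ℝ), s ≠ b := by simp [ae_iff]
  filter_upwards [this] with s hs hs'
  rw [uIoc_of_le hab] at hs'
  exact ⟨hs'.1.le, lt_of_le_of_ne hs'.2 hs⟩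

theorem intervalIntegral_congr_Ico [NormedSpace ℝ E] {f g : ℝ → E} {a b : ℝ} (hab : a ≤ b)
    (h : ∀ s ∈ Ico a b, f s = g s) : ∫ s in a..b, f s = ∫ s in a..b, g s := by
  refine intervalIntegral.integral_congr_ae ?_
  filter_upwards [ae_uIoc_mem_Ico hab] with s hs hs'
  exact h s (hs hs')

theorem intervalIntegrable_congr_Ico {f g : ℝ → E} {a b : ℝ} (hab : a ≤ b)
    (h : ∀ s ∈ Ico a b, f s = g s) (hf : IntervalIntegrable f volume a b) :
    IntervalIntegrable g volume a b := by
  refine hf.congr_ae ?_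
  rw [Filter.EventuallyEq, ae_restrict_iff' measurableSet_uIoc]
  filter_upwards [ae_uIoc_mem_Ico hab] with s hs hs'
  exact h s (hs hs')

end IntervalHelpers

theorem measurable_haar : Measurable haar :=
  Measurable.ite measurableSet_Ico measurable_const
    (Measurable.ite measurableSet_Ico measurable_const measurable_const)

theorem measurable_haarBasis (k j : ℕ) : Measurable (haarBasis k j) :=
  measurable_haar.comp (by fun_prop)

theorem norm_haar_le (t : ℝ) : ‖haar t‖ ≤ 1 := by
  unfold haar; split_ifs <;> simp

theorem integrableOn_haarBasis (k j : ℕ) : IntegrableOn (haarBasis k j) (Icc 0 1) :=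
  Integrable.of_bound (measurable_haarBasis k j).aestronglyMeasurable 1
    (Filter.Eventually.of_forall fun _ => norm_haar_le _)

theorem haarBasis_eq_one {k j : ℕ} {t : ℝ} (h : (j : ℝ) ≤ 2 ^ k * t)
    (h' : 2 ^ k * t < j + 1 / 2) : haarBasis k j t = 1 := by
  unfold haarBasis haar
  rw [if_pos ⟨by linarith, by linarith⟩]

theorem haarBasis_eq_neg_one {k j : ℕ} {t : ℝ} (h : (j : ℝ) + 1 / 2 ≤ 2 ^ k * t)
    (h' : 2 ^ k * t < j + 1) : haarBasis k j t = -1 := by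
  unfold haarBasis haar
  rw [if_neg fun h => by linarith [h.2], if_pos ⟨by linarith, by linarith⟩]

theorem haarBasis_eq_zero {k j : ℕ} {t : ℝ} (h : 2 ^ k * t < j ∨ (j : ℝ) + 1 ≤ 2 ^ k * t) :
    haarBasis k j t = 0 := by
  unfold haarBasis haar
  rw [if_neg fun h1 => ?_, if_neg fun h1 => ?_]
  · rcases h with h | h <;> linarith [h1.1, h1.2]
  · rcases h with h | h <;> linarith [h1.1, h1.2]

theorem dyadic_mem {k j : ℕ} (hj : j ≤ 2 ^ k) : (j : ℝ) / 2 ^ k ∈ Icc (0 : ℝ) 1 := by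
  refine ⟨by positivity, ?_⟩
  rw [div_le_one (by positivity)]
  exact_mod_cast hj

theorem innerL2_haarBasis {k j : ℕ} (hj : j < 2 ^ k) {g : ℝ → ℝ}
    (hg : IntegrableOn g (Icc 0 1)) :
    innerL2 g (haarBasis k j) =
      (∫ s in ((j : ℝ) / 2 ^ k)..((j + 1 / 2) / 2 ^ k), g s) -
        ∫ s in (((j : ℝ) + 1 / 2) / 2 ^ k)..((j + 1) / 2 ^ k), g s := by
  have hp : (0 : ℝ) < 2 ^ k := by positivity
  have h0 := dyadic_mem hj.le
  have h2 := dyadic_mem (k := k) (j := j + 1) hj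
  push_cast at h2
  set a : ℝ := j / 2 ^ k with ha
  set b : ℝ := (j + 1) / 2 ^ k with hb
  set m : ℝ := (j + 1 / 2) / 2 ^ k with hm
  have ham : a ≤ m := by rw [ha, hm]; gcongr; linarith
  have hmb : m ≤ b := by rw [hm, hb]; gcongr; norm_num
  have h1 : m ∈ Icc (0 : ℝ) 1 := ⟨h0.1.trans ham, hmb.trans h2.2⟩
  have ea : ∀ s, s < a ↔ 2 ^ k * s < j := fun s => by rw [ha, lt_div_iff₀' hp]
  have em : ∀ s, s < m ↔ 2 ^ k * s < j + 1 / 2 := fun s => by rw [hm, lt_div_iff₀' hp]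
  have eb : ∀ s, s < b ↔ 2 ^ k * s < j + 1 := fun s => by rw [hb, lt_div_iff₀' hp]
  have hI := fun {x y : ℝ} (hx : x ∈ Icc (0 : ℝ) 1) (hy : y ∈ Icc (0 : ℝ) 1) =>
    intervalIntegrable_of_integrableOn_Icc hg hx hy
  have e0 : (0 : ℝ) ∈ Icc (0 : ℝ) 1 := ⟨le_rfl, zero_le_one⟩
  have e1 : (1 : ℝ) ∈ Icc (0 : ℝ) 1 := ⟨zero_le_one, le_rfl⟩
  -- On the successive pieces of `0 ≤ a ≤ m ≤ b ≤ 1` the integrand is `0`, `g`, `-g`, `0`.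
  have c1 : ∀ s ∈ Ico 0 a, 0 = g s * haarBasis k j s := fun s hs => by
    rw [haarBasis_eq_zero (Or.inl ((ea s).1 hs.2)), mul_zero]
  have c2 : ∀ s ∈ Ico a m, g s = g s * haarBasis k j s := fun s hs => by
    rw [haarBasis_eq_one (not_lt.1 (mt (ea s).2 (not_lt.2 hs.1))) ((em s).1 hs.2), mul_one]
  have c3 : ∀ s ∈ Ico m b, -g s = g s * haarBasis k j s := fun s hs => by
    rw [haarBasis_eq_neg_one (not_lt.1 (mt (em s).2 (not_lt.2 hs.1))) ((eb s).1 hs.2),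
      mul_neg_one]
  have c4 : ∀ s ∈ Ico b 1, 0 = g s * haarBasis k j s := fun s hs => by
    rw [haarBasis_eq_zero (Or.inr (not_lt.1 (mt (eb s).2 (not_lt.2 hs.1)))), mul_zero]
  have i1 := intervalIntegrable_congr_Ico h0.1 c1 intervalIntegrable_const
  have i2 := intervalIntegrable_congr_Ico ham c2 (hI h0 h1)
  have i3 := intervalIntegrable_congr_Ico hmb c3 (hI h1 h2).neg
  have i4 := intervalIntegrable_congr_Ico h2.2 c4 intervalIntegrable_const
  rw [innerL2, ← intervalIntegral.integral_add_adjacent_intervals ((i1.trans i2).trans i3) i4,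
    ← intervalIntegral.integral_add_adjacent_intervals (i1.trans i2) i3,
    ← intervalIntegral.integral_add_adjacent_intervals i1 i2,
    ← intervalIntegral_congr_Ico h0.1 c1, ← intervalIntegral_congr_Ico ham c2,
    ← intervalIntegral_congr_Ico hmb c3, ← intervalIntegral_congr_Ico h2.2 c4]
  simp [sub_eq_add_neg]

theorem innerL2_haarBasis_self {k j : ℕ} (hj : j < 2 ^ k) :
    innerL2 (haarBasis k j) (haarBasis k j) = 1 / 2 ^ k := by
  have hp : (0 : ℝ) < 2 ^ k := by positivity
  rw [innerL2_haarBasis hj (integrableOn_haarBasis k j),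
    intervalIntegral_congr_Ico (g := fun _ => (1 : ℝ)) (by gcongr; linarith) fun s hs =>
      haarBasis_eq_one (by rw [← div_le_iff₀' hp]; exact hs.1)
        (by rw [← lt_div_iff₀' hp]; exact hs.2),
    intervalIntegral_congr_Ico (g := fun _ => (-1 : ℝ)) (by gcongr; norm_num) fun s hs =>
      haarBasis_eq_neg_one (by rw [← div_le_iff₀' hp]; exact hs.1)
        (by rw [← lt_div_iff₀' hp]; exact hs.2)]
  simp only [intervalIntegral.integral_const, smul_eq_mul]
  field_simp
  ring

/-- Induction on the level. At level `n` the only wavelet that can be nonzero at `t` is that of the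
parent interval. Adding or subtracting half the difference of the averages over its two halves turns
the average over the parent into the average over the child. -/
theorem haarSeries_eq_average {c : ℝ → ℝ} (hc : IntegrableOn c (Icc 0 1)) (n : ℕ) :
    ∀ {j : ℕ} {t : ℝ}, j < 2 ^ n → (j : ℝ) ≤ 2 ^ n * t → 2 ^ n * t < j + 1 →
      innerL2 c (fun _ => 1) + ∑ k ∈ Finset.range n, ∑ j ∈ Finset.range (2 ^ k),
        innerL2 c (haarBasis k j) * (haarBasis k j t / innerL2 (haarBasis k j) (haarBasis k j)) =
      2 ^ n * ∫ s in ((j : ℝ) / 2 ^ n)..((j + 1) / 2 ^ n), c s := by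
  induction n with
  | zero =>
    intro j t hj _ _
    have : j = 0 := by simpa using hj
    subst this
    simp [innerL2]
  | succ n ih =>
    intro j t hj h1 h2
    -- The parent interval is `i`; the parity of `j` tells which half contains `t`.
    obtain ⟨i, hi⟩ := Nat.even_or_odd' j
    have hin : i < 2 ^ n := by rw [pow_succ] at hj; omega
    have hp : (0 : ℝ) < 2 ^ n := by positivity
    rw [pow_succ] at h1 h2
    have hi1 : (i : ℝ) ≤ 2 ^ n * t := by
      rcases hi with hi | hi <;> rw [hi] at h1 <;> push_cast at h1 <;> linarith
    have hi2 : 2 ^ n * t < i + 1 := by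
      rcases hi with hi | hi <;> rw [hi] at h2 <;> push_cast at h2 <;> linarith
    have hsum : ∑ l ∈ Finset.range (2 ^ n), innerL2 c (haarBasis n l) *
        (haarBasis n l t / innerL2 (haarBasis n l) (haarBasis n l)) =
        innerL2 c (haarBasis n i) *
        (haarBasis n i t / innerL2 (haarBasis n i) (haarBasis n i)) := by
      refine Finset.sum_eq_single i (fun l _ hl => ?_)
        (fun h => absurd (Finset.mem_range.2 hin) h)
      rw [haarBasis_eq_zero, zero_div, mul_zero]
      rcases lt_or_gt_of_ne hl with hl | hl
      · right
        have : (l : ℝ) + 1 ≤ i := by exact_mod_cast hl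
        linarith
      · left
        have : (i : ℝ) + 1 ≤ l := by exact_mod_cast hl
        linarith
    have hm0 := dyadic_mem hin.le
    have hm2 := dyadic_mem (k := n) (j := i + 1) hin
    push_cast at hm2
    have ham : (i : ℝ) / 2 ^ n ≤ (i + 1 / 2) / 2 ^ n := by gcongr; linarith
    have hmb : ((i : ℝ) + 1 / 2) / 2 ^ n ≤ (i + 1) / 2 ^ n := by gcongr; norm_num
    have hm1 : ((i : ℝ) + 1 / 2) / 2 ^ n ∈ Icc (0 : ℝ) 1 :=
      ⟨hm0.1.trans ham, hmb.trans hm2.2⟩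
    rw [Finset.sum_range_succ, ← add_assoc, ih hin hi1 hi2, hsum, innerL2_haarBasis_self hin,
      innerL2_haarBasis hin hc, ← intervalIntegral.integral_add_adjacent_intervals
        (intervalIntegrable_of_integrableOn_Icc hc hm0 hm1)
        (intervalIntegrable_of_integrableOn_Icc hc hm1 hm2)]
    rcases hi with hi | hi
    · rw [haarBasis_eq_one hi1 (by rw [hi] at h2; push_cast at h2; linarith)]
      have e1 : (j : ℝ) / 2 ^ (n + 1) = i / 2 ^ n := by
        rw [hi, pow_succ]; push_cast; field_simp
      have e2 : ((j : ℝ) + 1) / 2 ^ (n + 1) = (i + 1 / 2) / 2 ^ n := by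
        rw [hi, pow_succ]; push_cast; field_simp
      rw [e1, e2, pow_succ]
      simp only [div_div_eq_mul_div, div_one]
      ring
    · rw [haarBasis_eq_neg_one (by rw [hi] at h1; push_cast at h1; linarith) hi2]
      have e1 : (j : ℝ) / 2 ^ (n + 1) = (i + 1 / 2) / 2 ^ n := by
        rw [hi, pow_succ]; push_cast; field_simp
      have e2 : ((j : ℝ) + 1) / 2 ^ (n + 1) = (i + 1) / 2 ^ n := by
        rw [hi, pow_succ]; push_cast; field_simp; ring
      rw [e1, e2, pow_succ]
      simp only [div_div_eq_mul_div, div_one]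
      ring

/-- The levels `0, …, N` resolve intervals of length `2^(-(N+1))`, half the period of the
modulation. -/
theorem haarTruncVec_eq_average {r : ℕ} {c : ℝ → Vec r} (hc : IntegrableOn c (Icc 0 1)) {N j : ℕ}
    {t : ℝ} (hj : j < 2 ^ (N + 1)) (h1 : (j : ℝ) ≤ 2 ^ (N + 1) * t)
    (h2 : 2 ^ (N + 1) * t < j + 1) :
    haarTruncVec N c t =
      (2 : ℝ) ^ (N + 1) • ∫ s in ((j : ℝ) / 2 ^ (N + 1))..((j + 1) / 2 ^ (N + 1)), c s := by
  ext i
  have hci : IntegrableOn (fun s => c s i) (Icc 0 1) :=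
    (EuclideanSpace.proj i : Vec r →L[ℝ] ℝ).integrable_comp hc
  have hm2 := dyadic_mem (k := N + 1) (j := j + 1) hj
  push_cast at hm2
  have h := (EuclideanSpace.proj i : Vec r →L[ℝ] ℝ).intervalIntegral_comp_comm
    (intervalIntegrable_of_integrableOn_Icc hc (dyadic_mem hj.le) hm2)
  have h3 := haarSeries_eq_average hci (N + 1) hj h1 h2
  exact h3.trans (congrArg (2 ^ (N + 1) * ·) h)

theorem inv_smul_integral_mem_of_convex {E : Type*} [NormedAddCommGroup E] [NormedSpace ℝ E]
    [FiniteDimensional ℝ E] {s : Set E} {g : ℝ → E} (hs : Convex ℝ s) {a b : ℝ} (hab : a < b)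
    (hg : IntervalIntegrable g volume a b) (hgs : ∀ t ∈ Ioc a b, g t ∈ s) :
    (b - a)⁻¹ • ∫ t in a..b, g t ∈ s := by
  rw [← interval_average_eq, uIoc_of_le hab.le, average]
  have : NeZero (volume.restrict (Ioc a b)) := ⟨by
    rw [Ne, Measure.restrict_eq_zero]; simp [hab]⟩
  refine integral_mem_of_convex hs ?_ ?_
  · have := hg.1
    exact Integrable.to_average this
  · exact Measure.ae_smul_measure (by
      filter_upwards [ae_restrict_mem measurableSet_Ioc] with t ht using hgs t ht) _

/-- The average is taken over one half of the `k`-th cell. The uses are `Y = U`, the simplex, and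
closed balls around a value of `c`. -/
theorem haarTruncVec_mem_of_convex {r : ℕ} {c : ℝ → Vec r} (hc : IntegrableOn c (Icc 0 1))
    {Y : Set (Vec r)} (hY : Convex ℝ Y) {N k : ℕ} {t : ℝ} (hk : k < 2 ^ N)
    (h1 : (k : ℝ) ≤ 2 ^ N * t) (h2 : 2 ^ N * t < k + 1)
    (hcY : ∀ s ∈ Icc ((k : ℝ) / 2 ^ N) ((k + 1) / 2 ^ N), c s ∈ Y) :
    haarTruncVec N c t ∈ Y := by
  obtain ⟨j, hj, hj1, hj2, hjk⟩ : ∃ j : ℕ, j < 2 ^ (N + 1) ∧ (j : ℝ) ≤ 2 ^ (N + 1) * t ∧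
      2 ^ (N + 1) * t < j + 1 ∧ (j = 2 * k ∨ j = 2 * k + 1) := by
    rcases lt_or_ge (2 ^ N * t) (k + 1 / 2) with h | h
    · refine ⟨2 * k, by rw [pow_succ]; omega, ?_, ?_, Or.inl rfl⟩ <;>
      · rw [pow_succ]; push_cast; linarith
    · refine ⟨2 * k + 1, by rw [pow_succ]; omega, ?_, ?_, Or.inr rfl⟩ <;>
      · rw [pow_succ]; push_cast; linarith
  rw [haarTruncVec_eq_average hc hj hj1 hj2]
  have hm2 := dyadic_mem (k := N + 1) (j := j + 1) hj
  push_cast at hm2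
  have hlt : (j : ℝ) / 2 ^ (N + 1) < (j + 1) / 2 ^ (N + 1) := by gcongr; linarith
  have key := inv_smul_integral_mem_of_convex hY hlt
    (intervalIntegrable_of_integrableOn_Icc hc (dyadic_mem hj.le) hm2) (fun s hs => hcY s ?_)
  · convert key using 2
    field_simp
    ring
  · have hp : (0 : ℝ) < 2 ^ N := by positivity
    have hs1 := hs.1
    have hs2 := hs.2
    rw [pow_succ, div_lt_iff₀ (by positivity)] at hs1
    rw [pow_succ, le_div_iff₀ (by positivity)] at hs2
    constructor
    · rw [div_le_iff₀ hp]
      rcases hjk with rfl | rfl <;> push_cast at hs1 <;> linarith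
    · rw [le_div_iff₀ hp]
      rcases hjk with rfl | rfl <;> push_cast at hs2 <;> linarith

theorem measurable_haarTruncVec {r : ℕ} (N : ℕ) (c : ℝ → Vec r) :
    Measurable (haarTruncVec N c) := by
  refine (WithLp.measurable_toLp 2 _).comp (measurable_pi_lambda _ fun i => ?_)
  unfold haarTrunc
  refine measurable_const.add (Finset.measurable_sum _ fun k _ =>
    Finset.measurable_sum _ fun j _ => ?_)
  exact ((measurable_haarBasis k j).div_const _).const_mul _

theorem exists_dyadic_index {t : ℝ} (ht : t ∈ Ico (0 : ℝ) 1) (N : ℕ) :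
    ∃ k : ℕ, k < 2 ^ N ∧ (k : ℝ) ≤ 2 ^ N * t ∧ 2 ^ N * t < k + 1 := by
  have hp : (0 : ℝ) < 2 ^ N := by positivity
  refine ⟨⌊2 ^ N * t⌋₊, ?_, Nat.floor_le (mul_nonneg hp.le ht.1), Nat.lt_floor_add_one _⟩
  rw [Nat.floor_lt (mul_nonneg hp.le ht.1)]
  push_cast
  nlinarith [ht.2]

/-! ### Pulse-width modulation -/

theorem pwm_mem_Icc {q : ℕ} (N : ℕ) (d : ℝ → Vec q) (t : ℝ) (i : Fin q) :
    pwm N d t i ∈ Icc (0 : ℝ) 1 := by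
  simp only [pwm]
  split_ifs <;> simp

theorem measurable_pwm {q : ℕ} (N : ℕ) (d : ℝ → Vec q) : Measurable (pwm N d) := by
  refine (WithLp.measurable_toLp 2 _).comp (measurable_pi_lambda _ fun i => ?_)
  refine Measurable.ite ?_ measurable_const measurable_const
  have : {t : ℝ | ∃ k < 2 ^ N, t ∈ Ico
        (((k : ℕ) + ∑ j ∈ Finset.Iio i, d ((k : ℝ) / 2 ^ N) j) / 2 ^ N : ℝ)
        (((k : ℕ) + ∑ j ∈ Finset.Iic i, d ((k : ℝ) / 2 ^ N) j) / 2 ^ N : ℝ)} =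
      ⋃ k < 2 ^ N, Ico
        (((k : ℕ) + ∑ j ∈ Finset.Iio i, d ((k : ℝ) / 2 ^ N) j) / 2 ^ N : ℝ)
        (((k : ℕ) + ∑ j ∈ Finset.Iic i, d ((k : ℝ) / 2 ^ N) j) / 2 ^ N : ℝ) := by
    ext t
    simp only [mem_ofPred_eq, mem_iUnion, exists_prop]
  rw [this]
  exact MeasurableSet.iUnion fun k => MeasurableSet.iUnion fun _ => measurableSet_Ico

theorem sum_Iio_nonneg {q : ℕ} {v : Vec q} (hv : v ∈ simplex q) (i : Fin q) :
    0 ≤ ∑ j ∈ Finset.Iio i, v j := Finset.sum_nonneg fun j _ => (hv.1 j).1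

theorem sum_Iic_le_one {q : ℕ} {v : Vec q} (hv : v ∈ simplex q) (i : Fin q) :
    ∑ j ∈ Finset.Iic i, v j ≤ 1 := by
  rw [← hv.2]
  exact Finset.sum_le_sum_of_subset_of_nonneg (Finset.subset_univ _) fun j _ _ => (hv.1 j).1

theorem sum_Iic_eq {q : ℕ} (v : Vec q) (i : Fin q) :
    ∑ j ∈ Finset.Iic i, v j = v i + ∑ j ∈ Finset.Iio i, v j := by
  rw [← Finset.Iio_insert, Finset.sum_insert (by simp)]

/-- Partial sums of a point of the simplex lie in `[0,1]`, so the pulse of a cell never leaves that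
cell. -/
theorem pwm_apply_of_mem {q : ℕ} {N : ℕ} {d : ℝ → Vec q} {k : ℕ} (hk : k < 2 ^ N)
    (hd : ∀ k : ℕ, k < 2 ^ N → d ((k : ℝ) / 2 ^ N) ∈ simplex q) {t : ℝ}
    (h1 : (k : ℝ) ≤ 2 ^ N * t) (h2 : 2 ^ N * t < k + 1) (i : Fin q) :
    pwm N d t i = (Ico ((k + ∑ j ∈ Finset.Iio i, d ((k : ℝ) / 2 ^ N) j) / 2 ^ N : ℝ)
        ((k + ∑ j ∈ Finset.Iic i, d ((k : ℝ) / 2 ^ N) j) / 2 ^ N : ℝ)).indicator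
          (fun _ => (1 : ℝ)) t := by
  have hp : (0 : ℝ) < 2 ^ N := by positivity
  simp only [pwm, indicator]
  refine if_congr ⟨?_, fun h => ⟨k, hk, h⟩⟩ rfl rfl
  rintro ⟨l, hl, hl1, hl2⟩
  have e1 := sum_Iio_nonneg (hd l hl) i
  have e2 := sum_Iic_le_one (hd l hl) i
  have g1 := hl1
  have g2 := hl2
  rw [div_le_iff₀' hp] at g1
  rw [lt_div_iff₀' hp] at g2
  have : l = k := by
    have u1 : (l : ℝ) < k + 1 := by linarith
    have u2 : (k : ℝ) < l + 1 := by linarith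
    norm_cast at u1 u2
    omega
  subst this
  exact ⟨hl1, hl2⟩

/-- The pulse of mode `i` has length `dᵢ 2⁻ᴺ`: modulation preserves the mean of the sample over each
cell. -/
theorem integral_pwm {q : ℕ} {N : ℕ} {d : ℝ → Vec q} {k : ℕ} (hk : k < 2 ^ N)
    (hd : ∀ k : ℕ, k < 2 ^ N → d ((k : ℝ) / 2 ^ N) ∈ simplex q) (i : Fin q) :
    ∫ t in ((k : ℝ) / 2 ^ N)..((k + 1) / 2 ^ N), pwm N d t i = d ((k : ℝ) / 2 ^ N) i / 2 ^ N := by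
  have hp : (0 : ℝ) < 2 ^ N := by positivity
  have e1 := sum_Iio_nonneg (hd k hk) i
  have e2 := sum_Iic_le_one (hd k hk) i
  have e3 := ((hd k hk).1 i).1
  have e4 := sum_Iic_eq (d ((k : ℝ) / 2 ^ N)) i
  rw [intervalIntegral_congr_Ico (by gcongr; linarith) fun t ht => pwm_apply_of_mem hk hd
    (by rw [← div_le_iff₀' hp]; exact ht.1) (by rw [← lt_div_iff₀' hp]; exact ht.2) i]
  set a : ℝ := (k + ∑ j ∈ Finset.Iio i, d ((k : ℝ) / 2 ^ N) j) / 2 ^ N with ha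
  set b : ℝ := (k + ∑ j ∈ Finset.Iic i, d ((k : ℝ) / 2 ^ N) j) / 2 ^ N with hb
  have hka : (k : ℝ) / 2 ^ N ≤ a := by rw [ha]; gcongr; linarith
  have hab : a ≤ b := by rw [ha, hb, e4]; gcongr; linarith
  have hbk : b ≤ (k + 1) / 2 ^ N := by rw [hb]; gcongr
  rw [intervalIntegral.integral_of_le (hka.trans (hab.trans hbk)), 
    ← integral_Ico_eq_integral_Ioc,
    setIntegral_indicator measurableSet_Ico, Ico_inter_Ico, max_eq_right hka, min_eq_right hbk]
  simp only [integral_const, smul_eq_mul, mul_one, measureReal_restrict_apply_univ,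
    Real.volume_real_Ico_of_le hab]
  rw [ha, hb, e4]
  ring

/-! ### Variation functions -/

/-- The variation of `c` on `[0, t]`. -/
noncomputable def variationUpTo {r : ℕ} (c : ℝ → Vec r) (t : ℝ) : ℝ :=
  (eVariationOn (fun t => WithLp.toLp 1 (WithLp.ofLp (c t)) : ℝ → PiLp 1 (fun _ : Fin r => ℝ))
    (Icc 0 t)).toReal

theorem variationUpTo_zero {r : ℕ} (c : ℝ → Vec r) : variationUpTo c 0 = 0 := by
  simp [variationUpTo, eVariationOn.subsingleton]

theorem variationUpTo_one {r : ℕ} (c : ℝ → Vec r) :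
    variationUpTo c 1 = (totalVariation c).toReal := rfl

theorem norm_le_sum_norm {r : ℕ} (v : Vec r) : ‖v‖ ≤ ∑ i, ‖v i‖ := by
  rw [EuclideanSpace.norm_eq]
  refine Real.sqrt_le_iff.2 ⟨Finset.sum_nonneg fun _ _ => norm_nonneg _, ?_⟩
  exact Finset.sum_sq_le_sq_sum_of_nonneg fun _ _ => norm_nonneg _

/-- The variation is additive over adjacent intervals, and the Euclidean norm is at most the
`1`-norm in which it is measured. -/
theorem norm_sub_le_variation {r : ℕ} {c : ℝ → Vec r} (hc : totalVariation c < ∞) {s t : ℝ}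
    (hs : 0 ≤ s) (hst : s ≤ t) (ht : t ≤ 1) :
    ‖c t - c s‖ ≤ variationUpTo c t - variationUpTo c s := by
  set g : ℝ → PiLp 1 (fun _ : Fin r => ℝ) := fun t => WithLp.toLp 1 (WithLp.ofLp (c t)) with hg
  have hfin : ∀ t ≤ 1, eVariationOn g (Icc 0 t) ≠ ∞ := fun t ht =>
    ((eVariationOn.mono g (Icc_subset_Icc_right ht)).trans_lt hc).ne
  have h1 : eVariationOn g (Icc 0 s) + edist (g t) (g s) ≤ eVariationOn g (Icc 0 t) := by
    have := eVariationOn.Icc_add_Icc g (s := univ) hs hst (mem_univ _)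
    simp only [univ_inter] at this
    rw [← this]
    gcongr
    exact eVariationOn.edist_le g ⟨hst, le_rfl⟩ ⟨le_rfl, hst⟩
  have h2 := ENNReal.toReal_mono (hfin t ht) h1
  rw [ENNReal.toReal_add (hfin s (hst.trans ht)) (edist_ne_top _ _), ← dist_edist,
    dist_eq_norm, PiLp.norm_eq_of_L1] at h2
  have h3 : ‖c t - c s‖ ≤ ∑ i, ‖(g t - g s) i‖ := norm_le_sum_norm (c t - c s)
  have h4 : variationUpTo c t = (eVariationOn g (Icc 0 t)).toReal := rfl
  have h5 : variationUpTo c s = (eVariationOn g (Icc 0 s)).toReal := rfl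
  linarith

theorem variationUpTo_mono {r : ℕ} {c : ℝ → Vec r} (hc : totalVariation c < ∞) {s t : ℝ}
    (hs : 0 ≤ s) (hst : s ≤ t) (ht : t ≤ 1) : variationUpTo c s ≤ variationUpTo c t :=
  sub_nonneg.1 ((norm_nonneg _).trans (norm_sub_le_variation hc hs hst ht))

theorem norm_sub_le_variation_of_mem {r : ℕ} {c : ℝ → Vec r} (hc : totalVariation c < ∞)
    {a b s t : ℝ} (ha : 0 ≤ a) (hb : b ≤ 1) (hs : s ∈ Icc a b) (ht : t ∈ Icc a b) :
    ‖c s - c t‖ ≤ variationUpTo c b - variationUpTo c a := by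
  wlog hst : t ≤ s generalizing s t
  · rw [norm_sub_rev]
    exact this ht hs (not_le.1 hst).le
  have h1 := norm_sub_le_variation hc (ha.trans ht.1) hst (hs.2.trans hb)
  have h2 := variationUpTo_mono hc ha ht.1 (ht.2.trans hb)
  have h3 := variationUpTo_mono hc (ha.trans hs.1) hs.2 hb
  linarith

/-! ### Integrals over dyadic partitions -/

/-- The increments of `V` telescope over the complete cells before `t`; the incomplete cell
containing `t` is estimated by its length times `B`. -/
theorem norm_integral_le_of_dyadic {E : Type*} [NormedAddCommGroup E] [NormedSpace ℝ E]
    {Ψ : ℝ → E} (hΨ : IntegrableOn Ψ (Icc 0 1)) {V : ℝ → ℝ} {a b B : ℝ} (ha : 0 ≤ a) (hb : 0 ≤ b)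
    (hB : ∀ s ∈ Ico (0 : ℝ) 1, ‖Ψ s‖ ≤ B) (hV : ∀ s ∈ Icc (0 : ℝ) 1, V s ≤ V 1) (N : ℕ)
    (h : ∀ k : ℕ, k < 2 ^ N → ‖∫ s in ((k : ℝ) / 2 ^ N)..((k + 1) / 2 ^ N), Ψ s‖ ≤
      1 / 2 ^ N * (a * (1 / 2 ^ N) + b * (V ((k + 1) / 2 ^ N) - V (k / 2 ^ N)))) :
    ∀ t ∈ Icc (0 : ℝ) 1, ‖∫ s in (0 : ℝ)..t, Ψ s‖ ≤ 1 / 2 ^ N * (a + b * (V 1 - V 0) + B) := by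
  have hp : (0 : ℝ) < 2 ^ N := by positivity
  have h0 : (0 : ℝ) ∈ Icc (0 : ℝ) 1 := ⟨le_rfl, zero_le_one⟩
  have hB0 : 0 ≤ B := (norm_nonneg _).trans (hB 0 ⟨le_rfl, zero_lt_one⟩)
  have key : ∀ k : ℕ, k ≤ 2 ^ N → ‖∫ s in (0 : ℝ)..((k : ℝ) / 2 ^ N), Ψ s‖ ≤
      1 / 2 ^ N * (a * ((k : ℝ) / 2 ^ N) + b * (V (k / 2 ^ N) - V 0)) := by
    intro k
    induction k with
    | zero => simp
    | succ k ih =>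
      intro hk
      have h1 := ih (by omega)
      have h2 := h k hk
      have m1 := dyadic_mem (k := N) (j := k) (by omega)
      have m2 := dyadic_mem (k := N) (j := k + 1) hk
      push_cast at m2 ⊢
      rw [← intervalIntegral.integral_add_adjacent_intervals
        (intervalIntegrable_of_integrableOn_Icc hΨ h0 m1)
        (intervalIntegrable_of_integrableOn_Icc hΨ m1 m2)]
      refine (norm_add_le _ _).trans ((add_le_add h1 h2).trans (le_of_eq ?_))
      ring
  have key' : ∀ k : ℕ, k ≤ 2 ^ N → ‖∫ s in (0 : ℝ)..((k : ℝ) / 2 ^ N), Ψ s‖ ≤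
      1 / 2 ^ N * (a + b * (V 1 - V 0)) := by
    intro k hk
    have hm := dyadic_mem hk
    refine (key k hk).trans ?_
    have := hV _ hm
    gcongr
    nlinarith [hm.2]
  intro t ht
  rcases eq_or_lt_of_le ht.2 with rfl | ht1
  · have := key' (2 ^ N) le_rfl
    push_cast at this
    rw [div_self hp.ne'] at this
    refine this.trans (mul_le_mul_of_nonneg_left ?_ (by positivity))
    linarith
  · obtain ⟨k, hk, hk1, hk2⟩ := exists_dyadic_index ⟨ht.1, ht1⟩ N
    have hm := dyadic_mem hk.le
    have hkt : (k : ℝ) / 2 ^ N ≤ t := by rwa [div_le_iff₀' hp]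
    have htk : t - k / 2 ^ N ≤ 1 / 2 ^ N := by
      rw [sub_le_iff_le_add, ← add_div, le_div_iff₀' hp]
      linarith
    rw [← intervalIntegral.integral_add_adjacent_intervals
      (intervalIntegrable_of_integrableOn_Icc hΨ h0 hm)
      (intervalIntegrable_of_integrableOn_Icc hΨ hm ht)]
    have h2 : ‖∫ s in ((k : ℝ) / 2 ^ N)..t, Ψ s‖ ≤ 1 / 2 ^ N * B := by
      refine (norm_integral_le_of_norm_le_Ico hkt (intervalIntegrable_const (c := B))
        fun s hs => hB s ⟨hm.1.trans hs.1, hs.2.trans ht1⟩).trans ?_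
      rw [intervalIntegral.integral_const, smul_eq_mul]
      gcongr
    refine (norm_add_le _ _).trans ((add_le_add (key' k hk.le) h2).trans (le_of_eq ?_))
    ring

/-! ### The switched system -/

/-- The properties of an input that are used to solve the differential equation. -/
structure Admissible {m q : ℕ} (U : Set (Vec m)) (ξ : Input m q) : Prop where
  measurable_fst : AEStronglyMeasurable ξ.1 (volume.restrict (Icc (0 : ℝ) 1))
  measurable_snd : AEStronglyMeasurable ξ.2 (volume.restrict (Icc (0 : ℝ) 1))
  fst_mem : ∀ s ∈ Ico (0 : ℝ) 1, ξ.1 s ∈ U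
  snd_mem : ∀ s ∈ Ico (0 : ℝ) 1, ∀ i, ξ.2 s i ∈ Icc (0 : ℝ) 1

section System

variable {n m q : ℕ} {f : VectorFields n m q} {U : Set (Vec m)} {L : ℝ}

/-- Serves measurability: `f` is controlled only for `u ∈ U`, whereas a continuous `F` can be
composed with any measurable input. -/
theorem Regular.exists_continuous_extension (hf : Regular f U L) (i : Fin q) :
    ∃ F : ℝ × Vec n × Vec m → Vec n, Continuous F ∧
      ∀ t ∈ Icc (0 : ℝ) 1, ∀ x, ∀ u ∈ U, f t x u i = F (t, x, u) := by
  have hL := hf.pos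
  -- The product carries the max metric, which bounds each of the three terms.
  have hlip : LipschitzOnWith (3 * L).toNNReal
      (fun p : ℝ × Vec n × Vec m => f p.1 p.2.1 p.2.2 i) (Icc (0 : ℝ) 1 ×ˢ univ ×ˢ U) := by
    refine LipschitzOnWith.of_dist_le_mul fun p hp r hr => ?_
    rw [dist_eq_norm, Real.coe_toNNReal _ (by positivity)]
    refine (hf.lipschitz i _ hp.1 _ hr.1 _ _ _ hp.2.2 _ hr.2.2).trans ?_
    have h1 : |p.1 - r.1| ≤ dist p r := by
      rw [← Real.dist_eq]; exact le_max_left _ _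
    have h2 : ‖p.2.1 - r.2.1‖ ≤ dist p r := by
      rw [← dist_eq_norm]
      exact (le_max_left _ _ : _ ≤ dist p.2 r.2).trans (le_max_right _ _)
    have h3 : ‖p.2.2 - r.2.2‖ ≤ dist p r := by
      rw [← dist_eq_norm]
      exact (le_max_right _ _ : _ ≤ dist p.2 r.2).trans (le_max_right _ _)
    nlinarith
  obtain ⟨F, hF, hFf⟩ := hlip.extend_finite_dimension
  exact ⟨F, hF.continuous, fun t ht x u hu => hFf (x := (t, x, u)) ⟨ht, mem_univ _, hu⟩⟩

theorem Regular.exists_bound (hf : Regular f U L) (hU : Bornology.IsBounded U) :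
    ∃ C : ℝ, 0 ≤ C ∧ ∀ i, ∀ t ∈ Icc (0 : ℝ) 1, ∀ u ∈ U, ‖f t 0 u i‖ ≤ C := by
  have hL := hf.pos
  have h0 : (0 : ℝ) ∈ Icc (0 : ℝ) 1 := ⟨le_rfl, zero_le_one⟩
  rcases U.eq_empty_or_nonempty with rfl | ⟨u₀, hu₀⟩
  · exact ⟨0, le_rfl, fun i t ht u hu => hu.elim⟩
  refine ⟨(∑ i, ‖f 0 0 u₀ i‖) + L * (1 + Metric.diam U), by positivity, fun i t ht u hu => ?_⟩
  have h1 := hf.lipschitz i t ht 0 h0 0 0 u hu u₀ hu₀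
  have h2 : ‖f 0 0 u₀ i‖ ≤ ∑ i, ‖f 0 0 u₀ i‖ :=
    Finset.single_le_sum (f := fun i => ‖f 0 0 u₀ i‖) (fun _ _ => norm_nonneg _)
      (Finset.mem_univ i)
  have h3 : ‖u - u₀‖ ≤ Metric.diam U := by
    rw [← dist_eq_norm]; exact Metric.dist_le_diam_of_mem hU hu hu₀
  have h4 : |t - 0| ≤ 1 := by rw [sub_zero, abs_of_nonneg ht.1]; exact ht.2
  have h5 := norm_sub_norm_le (f t 0 u i) (f 0 0 u₀ i)
  have h6 : L * (|t - 0| + ‖(0 : Vec n) - 0‖ + ‖u - u₀‖) ≤ L * (1 + Metric.diam U) := by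
    rw [sub_zero (0 : Vec n), norm_zero, add_zero]
    gcongr
  linarith

/-- Only `dᵢ ∈ [0,1]` is used, so the modes add up to a factor `q`; `q + 1` keeps the constant
positive when `q = 0`. -/
theorem Regular.norm_relaxedField_sub_le (hf : Regular f U L) {t₁ t₂ : ℝ}
    (h₁ : t₁ ∈ Icc (0 : ℝ) 1) (h₂ : t₂ ∈ Icc (0 : ℝ) 1) (x₁ x₂ : Vec n) {u₁ u₂ : Vec m}
    (hu₁ : u₁ ∈ U) (hu₂ : u₂ ∈ U) {d : Vec q} (hd : ∀ i, d i ∈ Icc (0 : ℝ) 1) :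
    ‖relaxedField f t₁ x₁ u₁ d - relaxedField f t₂ x₂ u₂ d‖ ≤
      (q + 1) * L * (|t₁ - t₂| + ‖x₁ - x₂‖ + ‖u₁ - u₂‖) := by
  have hL := hf.pos
  have h : ∀ i ∈ Finset.univ, ‖d i • f t₁ x₁ u₁ i - d i • f t₂ x₂ u₂ i‖ ≤
      L * (|t₁ - t₂| + ‖x₁ - x₂‖ + ‖u₁ - u₂‖) := fun i _ => by
    rw [← smul_sub, norm_smul, Real.norm_of_nonneg (hd i).1]
    exact (mul_le_of_le_one_left (norm_nonneg _) (hd i).2).trans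
      (hf.lipschitz i _ h₁ _ h₂ _ _ _ hu₁ _ hu₂)
  rw [relaxedField, relaxedField, ← Finset.sum_sub_distrib]
  refine (norm_sum_le_of_le _ h).trans ?_
  rw [Finset.sum_const, Finset.card_univ, Fintype.card_fin, nsmul_eq_mul, mul_assoc]
  gcongr
  linarith

theorem norm_relaxedField_zero_le {C : ℝ} (hC0 : 0 ≤ C)
    (hC : ∀ i, ∀ t ∈ Icc (0 : ℝ) 1, ∀ u ∈ U, ‖f t 0 u i‖ ≤ C) {t : ℝ} (ht : t ∈ Icc (0 : ℝ) 1)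
    {u : Vec m} (hu : u ∈ U) {d : Vec q} (hd : ∀ i, d i ∈ Icc (0 : ℝ) 1) :
    ‖relaxedField f t 0 u d‖ ≤ (q + 1) * C := by
  have h : ∀ i ∈ Finset.univ, ‖d i • f t 0 u i‖ ≤ C := fun i _ => by
    rw [norm_smul, Real.norm_of_nonneg (hd i).1]
    exact (mul_le_of_le_one_left (norm_nonneg _) (hd i).2).trans (hC i t ht u hu)
  refine (norm_sum_le_of_le _ h).trans ?_
  rw [Finset.sum_const, Finset.card_univ, Fintype.card_fin, nsmul_eq_mul]
  gcongr
  linarith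

theorem Admissible.isCaratheodory {ξ : Input m q} (hξ : Admissible U ξ) (hf : Regular f U L)
    {C : ℝ} (hC0 : 0 ≤ C) (hC : ∀ i, ∀ t ∈ Icc (0 : ℝ) 1, ∀ u ∈ U, ‖f t 0 u i‖ ≤ C) :
    IsCaratheodory (fun s x => relaxedField f s x (ξ.1 s) (ξ.2 s)) ((q + 1) * L)
      ((q + 1) * C) where
  pos := by have := hf.pos; positivity
  lipschitz s hs x y := by
    have hs' := Ico_subset_Icc_self hs
    simpa using hf.norm_relaxedField_sub_le hs' hs' x y (hξ.fst_mem s hs) (hξ.fst_mem s hs)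
      (hξ.snd_mem s hs)
  bound s hs := norm_relaxedField_zero_le hC0 hC (Ico_subset_Icc_self hs) (hξ.fst_mem s hs)
    (hξ.snd_mem s hs)
  measurable x hx := by
    choose F hF hFf using hf.exists_continuous_extension
    have h : AEStronglyMeasurable (fun s => ∑ i, ξ.2 s i • F i (s, x s, ξ.1 s))
        (volume.restrict (Icc (0 : ℝ) 1)) := by
      refine Finset.aestronglyMeasurable_fun_sum _ fun i _ => ?_
      have h1 : AEStronglyMeasurable (fun s => ξ.2 s i) (volume.restrict (Icc (0 : ℝ) 1)) :=
        (EuclideanSpace.proj i : Vec q →L[ℝ] ℝ).continuous.comp_aestronglyMeasurable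
          hξ.measurable_snd
      have h2 : AEStronglyMeasurable (fun s => F i (s, x s, ξ.1 s))
          (volume.restrict (Icc (0 : ℝ) 1)) :=
        (hF i).comp_aestronglyMeasurable (aestronglyMeasurable_id.prodMk
          (hx.aestronglyMeasurable.prodMk hξ.measurable_fst))
      exact h1.smul h2
    refine h.congr ?_
    filter_upwards [ae_restrict_mem_Ico] with s hs
    refine Finset.sum_congr rfl fun i _ => ?_
    rw [hFf i s (Ico_subset_Icc_self hs) _ _ (hξ.fst_mem s hs)]

theorem IsTrajectory.continuousOn {x₀ : Vec n} {ξ : Input m q} {x : ℝ → Vec n}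
    (hx : IsTrajectory f x₀ ξ x) : ContinuousOn x (Icc 0 1) :=
  continuousOn_of_eq_add_integral
    ((intervalIntegrable_iff_integrableOn_Icc_of_le zero_le_one).1 hx.1) hx.2

theorem Admissible.hasUniqueTrajectory {ξ : Input m q} (hξ : Admissible U ξ)
    (hf : Regular f U L) (hU : Bornology.IsBounded U) (x₀ : Vec n) :
    HasUniqueTrajectory f x₀ ξ := by
  obtain ⟨C, hC0, hC⟩ := hf.exists_bound hU
  have hG := hξ.isCaratheodory hf hC0 hC
  obtain ⟨x, hxc, hx⟩ := hG.exists_solution x₀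
  exact ⟨x, ⟨intervalIntegrable_of_integrableOn_Icc (hG.integrableOn hxc) ⟨le_rfl, zero_le_one⟩
    ⟨zero_le_one, le_rfl⟩, hx⟩, fun y hy => hG.eqOn_of_solution hxc hy.continuousOn hx hy.2⟩

theorem HasUniqueTrajectory.isTrajectory_flow {x₀ : Vec n} {ξ : Input m q}
    (h : HasUniqueTrajectory f x₀ ξ) : IsTrajectory f x₀ ξ (fun t => flow f x₀ t ξ) := by
  obtain ⟨x, hx, -⟩ := h
  have he : ∃ x, IsTrajectory f x₀ ξ x := ⟨x, hx⟩
  have : (fun t => flow f x₀ t ξ) = he.choose := by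
    funext t
    rw [flow, dif_pos he]
  rw [this]
  exact he.choose_spec

theorem IsTrajectory.norm_sub_le {x₀ : Vec n} {ξ : Input m q} {x : ℝ → Vec n}
    (hx : IsTrajectory f x₀ ξ x) {M : ℝ}
    (hM : ∀ s ∈ Ico (0 : ℝ) 1, ‖relaxedField f s (x s) (ξ.1 s) (ξ.2 s)‖ ≤ M) {s t : ℝ}
    (hs : 0 ≤ s) (hst : s ≤ t) (ht : t ≤ 1) : ‖x t - x s‖ ≤ M * (t - s) := by
  have hi := (intervalIntegrable_iff_integrableOn_Icc_of_le zero_le_one).1 hx.1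
  have h0 : (0 : ℝ) ∈ Icc (0 : ℝ) 1 := ⟨le_rfl, zero_le_one⟩
  have ms : s ∈ Icc (0 : ℝ) 1 := ⟨hs, hst.trans ht⟩
  have mt : t ∈ Icc (0 : ℝ) 1 := ⟨hs.trans hst, ht⟩
  rw [hx.2 t mt, hx.2 s ms, add_sub_add_left_eq_sub, intervalIntegral.integral_interval_sub_left
    (intervalIntegrable_of_integrableOn_Icc hi h0 mt)
    (intervalIntegrable_of_integrableOn_Icc hi h0 ms)]
  refine (norm_integral_le_of_norm_le_Ico hst (intervalIntegrable_const (c := M))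
    fun r hr => hM r ⟨hs.trans hr.1, hr.2.trans_le ht⟩).trans (le_of_eq ?_)
  rw [intervalIntegral.integral_const, smul_eq_mul, mul_comm]

theorem Admissible.integrableOn_snd {ξ : Input m q} (hξ : Admissible U ξ) (i : Fin q) :
    IntegrableOn (fun s => ξ.2 s i) (Icc 0 1) := by
  refine Integrable.of_bound ((EuclideanSpace.proj i : Vec q →L[ℝ]
    ℝ).continuous.comp_aestronglyMeasurable hξ.measurable_snd) 1 ?_
  filter_upwards [ae_restrict_mem_Ico] with s hs
  have := hξ.snd_mem s hs i
  rw [Real.norm_of_nonneg this.1]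
  exact this.2

/-- On an interval on which the inputs have oscillation at most `δ`, and the discrete inputs
have almost the same integral, replacing one input by the other along a fixed curve has an effect
of second order. -/
theorem Regular.norm_integral_relaxedField_sub_le (hf : Regular f U L) {ξ ζ : Input m q}
    (hξ : Admissible U ξ) (hζ : Admissible U ζ) {x : ℝ → Vec n} {a b M δ : ℝ} (ha : 0 ≤ a)
    (hab : a < b) (hb : b ≤ 1)
    (hi : IntegrableOn (fun s => relaxedField f s (x s) (ζ.1 s) (ζ.2 s) -
      relaxedField f s (x s) (ξ.1 s) (ξ.2 s)) (Icc 0 1))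
    (hM : ∀ i, ‖f a (x a) (ξ.1 a) i‖ ≤ M)
    (hx : ∀ s ∈ Ico a b, ‖x s - x a‖ ≤ M * (b - a))
    (hu : ∀ s ∈ Ico a b, ‖ξ.1 s - ξ.1 a‖ ≤ δ) (hv : ∀ s ∈ Ico a b, ‖ζ.1 s - ξ.1 a‖ ≤ δ)
    (hd : ∀ i, |∫ s in a..b, (ζ.2 s i - ξ.2 s i)| ≤ (b - a) * δ) :
    ‖∫ s in a..b, (relaxedField f s (x s) (ζ.1 s) (ζ.2 s) -
      relaxedField f s (x s) (ξ.1 s) (ξ.2 s))‖ ≤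
      (b - a) * (2 * ((q + 1) * L) * (1 + M) * (b - a) + (2 * ((q + 1) * L) + q * M) * δ) := by
  have hL := hf.pos
  have hma : a ∈ Icc (0 : ℝ) 1 := ⟨ha, hab.le.trans hb⟩
  have hmb : b ∈ Icc (0 : ℝ) 1 := ⟨ha.trans hab.le, hb⟩
  have hua : ξ.1 a ∈ U := hξ.fst_mem a ⟨ha, hab.trans_le hb⟩
  set Ψ : ℝ → Vec n := fun s => relaxedField f s (x s) (ζ.1 s) (ζ.2 s) -
    relaxedField f s (x s) (ξ.1 s) (ξ.2 s) with hΨ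
  -- The field difference frozen at `a`. It is linear in the difference of the discrete inputs, so
  -- `hd` bounds its integral.
  set B : ℝ → Vec n := fun s => ∑ i, (ζ.2 s i - ξ.2 s i) • f a (x a) (ξ.1 a) i with hB
  have hdi : ∀ i, IntervalIntegrable (fun s => ζ.2 s i - ξ.2 s i) volume a b := fun i =>
    (intervalIntegrable_of_integrableOn_Icc (hζ.integrableOn_snd i) hma hmb).sub
      (intervalIntegrable_of_integrableOn_Icc (hξ.integrableOn_snd i) hma hmb)
  have hdi' : ∀ i, IntervalIntegrable (fun s => (ζ.2 s i - ξ.2 s i) • f a (x a) (ξ.1 a) i)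
      volume a b := fun i => ⟨(hdi i).1.smul_const _, (hdi i).2.smul_const _⟩
  have hBi : IntervalIntegrable B volume a b := by
    have h := IntervalIntegrable.sum Finset.univ fun i _ => hdi' i
    rwa [Finset.sum_fn] at h
  have hΨi : IntervalIntegrable Ψ volume a b := intervalIntegrable_of_integrableOn_Icc hi hma hmb
  have h1 : ‖∫ s in a..b, B s‖ ≤ q * ((b - a) * δ * M) := by
    rw [intervalIntegral.integral_finsetSum fun i _ => hdi' i]
    refine (norm_sum_le_of_le (f := fun i => ∫ s in a..b,
      (ζ.2 s i - ξ.2 s i) • f a (x a) (ξ.1 a) i) _ (n := fun _ => (b - a) * δ * M)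
      fun i _ => ?_).trans (by simp)
    rw [intervalIntegral.integral_smul_const, norm_smul, Real.norm_eq_abs]
    exact mul_le_mul (hd i) (hM i) (norm_nonneg _) ((abs_nonneg _).trans (hd i))
  have h2 : ‖∫ s in a..b, (Ψ s - B s)‖ ≤
      (b - a) * (2 * ((q + 1) * L * ((b - a) + M * (b - a) + δ))) := by
    refine (norm_integral_le_of_norm_le_Ico hab.le (intervalIntegrable_const
      (c := 2 * ((q + 1) * L * ((b - a) + M * (b - a) + δ)))) fun s hs => ?_).trans
      (le_of_eq (by rw [intervalIntegral.integral_const, smul_eq_mul]))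
    have hs' : s ∈ Ico (0 : ℝ) 1 := ⟨ha.trans hs.1, hs.2.trans_le hb⟩
    -- Each bracket has the same discrete value in both terms. The jumps of the modulated input,
    -- which are not small, therefore do not enter.
    have e : Ψ s - B s =
        (relaxedField f s (x s) (ζ.1 s) (ζ.2 s) - relaxedField f a (x a) (ξ.1 a) (ζ.2 s)) -
        (relaxedField f s (x s) (ξ.1 s) (ξ.2 s) - relaxedField f a (x a) (ξ.1 a) (ξ.2 s)) := by
      have : B s = relaxedField f a (x a) (ξ.1 a) (ζ.2 s) -
          relaxedField f a (x a) (ξ.1 a) (ξ.2 s) := by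
        simp only [hB, relaxedField, sub_smul, Finset.sum_sub_distrib]
      rw [this]
      exact sub_sub_sub_comm _ _ _ _
    have hsa : |s - a| ≤ b - a := by
      rw [abs_of_nonneg (by linarith [hs.1])]; linarith [hs.2]
    have n1 := hf.norm_relaxedField_sub_le (Ico_subset_Icc_self hs') hma (x s) (x a)
      (hζ.fst_mem s hs') hua (hζ.snd_mem s hs')
    have n2 := hf.norm_relaxedField_sub_le (Ico_subset_Icc_self hs') hma (x s) (x a)
      (hξ.fst_mem s hs') hua (hξ.snd_mem s hs')
    have n3 : (q + 1) * L * (|s - a| + ‖x s - x a‖ + ‖ζ.1 s - ξ.1 a‖) ≤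
        (q + 1) * L * ((b - a) + M * (b - a) + δ) := by
      gcongr
      · exact hx s hs
      · exact hv s hs
    have n4 : (q + 1) * L * (|s - a| + ‖x s - x a‖ + ‖ξ.1 s - ξ.1 a‖) ≤
        (q + 1) * L * ((b - a) + M * (b - a) + δ) := by
      gcongr
      · exact hx s hs
      · exact hu s hs
    rw [e]
    refine (norm_sub_le _ _).trans ?_
    linarith
  have h3 : ∫ s in a..b, Ψ s = (∫ s in a..b, (Ψ s - B s)) + ∫ s in a..b, B s := by
    rw [intervalIntegral.integral_sub hΨi hBi, sub_add_cancel]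
  rw [h3]
  refine (norm_add_le _ _).trans ((add_le_add h2 h1).trans (le_of_eq ?_))
  ring

end System

/-! ### The projected input -/

theorem convex_simplex (q : ℕ) : Convex ℝ (simplex q) := by
  intro v hv w hw a b ha hb hab
  have hsum : ∑ i, (a • v + b • w) i = 1 := by
    simp only [PiLp.add_apply, PiLp.smul_apply, smul_eq_mul, Finset.sum_add_distrib,
      ← Finset.mul_sum, hv.2, hw.2, mul_one, hab]
  refine ⟨fun i => ?_, hsum⟩
  exact convex_Icc (0 : ℝ) 1 (hv.1 i) (hw.1 i) ha hb hab

theorem L2BV_integrableOn {r : ℕ} {Y : Set (Vec r)} {c : ℝ → Vec r} (hc : c ∈ L2BV Y) :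
    IntegrableOn c (Icc 0 1) := hc.2.1.integrable one_le_two

theorem haarTruncVec_mem {r : ℕ} {Y : Set (Vec r)} (hY : Convex ℝ Y) {c : ℝ → Vec r}
    (hc : c ∈ L2BV Y) (N : ℕ) {t : ℝ} (ht : t ∈ Ico (0 : ℝ) 1) : haarTruncVec N c t ∈ Y := by
  obtain ⟨k, hk, h1, h2⟩ := exists_dyadic_index ht N
  have m1 := dyadic_mem hk.le
  have m2 := dyadic_mem (k := N) (j := k + 1) hk
  push_cast at m2
  exact haarTruncVec_mem_of_convex (L2BV_integrableOn hc) hY hk h1 h2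
    fun s hs => hc.1 s ⟨m1.1.trans hs.1, hs.2.trans m2.2⟩

/-- On the cell, `c` stays in the ball around `c s` whose radius is the variation there; by
convexity so does the average. -/
theorem norm_haarTruncVec_sub_le {r : ℕ} {Y : Set (Vec r)} {c : ℝ → Vec r} (hc : c ∈ L2BV Y)
    {N k : ℕ} (hk : k < 2 ^ N) {s t : ℝ}
    (ht : t ∈ Ico ((k : ℝ) / 2 ^ N) ((k + 1) / 2 ^ N))
    (hs : s ∈ Icc ((k : ℝ) / 2 ^ N) ((k + 1) / 2 ^ N)) :
    ‖haarTruncVec N c t - c s‖ ≤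
      variationUpTo c ((k + 1) / 2 ^ N) - variationUpTo c (k / 2 ^ N) := by
  have hp : (0 : ℝ) < 2 ^ N := by positivity
  have m1 := dyadic_mem hk.le
  have m2 := dyadic_mem (k := N) (j := k + 1) hk
  push_cast at m2
  have h := haarTruncVec_mem_of_convex (L2BV_integrableOn hc) (convex_closedBall (c s)
    (variationUpTo c ((k + 1) / 2 ^ N) - variationUpTo c (k / 2 ^ N))) hk
    ((div_le_iff₀' hp).1 ht.1) ((lt_div_iff₀' hp).1 ht.2) fun r hr => by
      rw [Metric.mem_closedBall, dist_eq_norm]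
      exact norm_sub_le_variation_of_mem hc.2.2 m1.1 m2.2 hr hs
  rwa [Metric.mem_closedBall, dist_eq_norm] at h

section

variable {m q : ℕ} {U : Set (Vec m)} {ξ : Input m q}

theorem admissible_of_mem_relaxedSpace (hξ : ξ ∈ relaxedSpace U q) : Admissible U ξ where
  measurable_fst := hξ.1.2.1.1
  measurable_snd := hξ.2.2.1.1
  fst_mem s hs := hξ.1.1 s (Ico_subset_Icc_self hs)
  snd_mem s hs := (hξ.2.1 s (Ico_subset_Icc_self hs)).1

theorem admissible_rho (hU : Convex ℝ U) (hξ : ξ ∈ relaxedSpace U q) (N : ℕ) :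
    Admissible U (rho N ξ) where
  measurable_fst := (measurable_haarTruncVec N ξ.1).aestronglyMeasurable
  measurable_snd := (measurable_pwm N _).aestronglyMeasurable
  fst_mem _ hs := haarTruncVec_mem hU hξ.1 N hs
  snd_mem s _ i := pwm_mem_Icc N _ s i

/-- The variation of the pair `ξ` on `[0, t]`. -/
noncomputable def inputVariation (ξ : Input m q) (t : ℝ) : ℝ :=
  variationUpTo ξ.1 t + variationUpTo ξ.2 t

theorem inputVariation_one (hξ : ξ ∈ relaxedSpace U q) : inputVariation ξ 1 = bvNorm ξ := by
  rw [inputVariation, variationUpTo_one, variationUpTo_one, bvNorm,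
    ENNReal.toReal_add hξ.1.2.2.ne hξ.2.2.2.ne]

/-- Over the cell the modulated input may be replaced by the constant sample of the truncation at
the left endpoint, which is within the variation of `ξ.2` on the cell. -/
theorem abs_integral_pwm_sub_le (hξ : ξ ∈ relaxedSpace U q) {N k : ℕ} (hk : k < 2 ^ N)
    (i : Fin q) :
    |∫ s in ((k : ℝ) / 2 ^ N)..((k + 1) / 2 ^ N), ((rho N ξ).2 s i - ξ.2 s i)| ≤
      1 / 2 ^ N * (variationUpTo ξ.2 ((k + 1) / 2 ^ N) - variationUpTo ξ.2 (k / 2 ^ N)) := by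
  have hp : (0 : ℝ) < 2 ^ N := by positivity
  have m1 := dyadic_mem hk.le
  have m2 := dyadic_mem (k := N) (j := k + 1) hk
  push_cast at m2
  have hle : (k : ℝ) / 2 ^ N < (k + 1) / 2 ^ N := by gcongr; linarith
  have hlen : ((k : ℝ) + 1) / 2 ^ N - k / 2 ^ N = 1 / 2 ^ N := by ring
  have hd : ∀ k : ℕ, k < 2 ^ N → haarTruncVec N ξ.2 ((k : ℝ) / 2 ^ N) ∈ simplex q :=
    fun k hk => haarTruncVec_mem (convex_simplex q) hξ.2 N
      ⟨(dyadic_mem hk.le).1, by rw [div_lt_one hp]; exact_mod_cast hk⟩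
  have hi1 : IntervalIntegrable (fun s => (rho N ξ).2 s i) volume ((k : ℝ) / 2 ^ N)
      ((k + 1) / 2 ^ N) := by
    refine intervalIntegrable_of_integrableOn_Icc (Integrable.of_bound
      ((EuclideanSpace.proj i : Vec q →L[ℝ] ℝ).continuous.comp_aestronglyMeasurable
        (measurable_pwm N _).aestronglyMeasurable) 1
      (Filter.Eventually.of_forall fun s => ?_)) m1 m2
    have := pwm_mem_Icc N (haarTruncVec N ξ.2) s i
    exact (Real.norm_of_nonneg this.1).trans_le this.2
  have hi2 := intervalIntegrable_of_integrableOn_Icc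
    ((admissible_of_mem_relaxedSpace hξ).integrableOn_snd i) m1 m2
  have hpwm : ∫ s in ((k : ℝ) / 2 ^ N)..((k + 1) / 2 ^ N), (rho N ξ).2 s i =
      ∫ _ in ((k : ℝ) / 2 ^ N)..((k + 1) / 2 ^ N), haarTruncVec N ξ.2 ((k : ℝ) / 2 ^ N) i := by
    rw [intervalIntegral.integral_const, hlen, smul_eq_mul]
    refine (integral_pwm hk hd i).trans ?_
    ring
  rw [intervalIntegral.integral_sub hi1 hi2, hpwm,
    ← intervalIntegral.integral_sub intervalIntegrable_const hi2, ← Real.norm_eq_abs]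
  refine (norm_integral_le_of_norm_le_Ico hle.le (intervalIntegrable_const (c :=
    variationUpTo ξ.2 ((k + 1) / 2 ^ N) - variationUpTo ξ.2 (k / 2 ^ N))) fun s hs => ?_).trans
    (le_of_eq (by rw [intervalIntegral.integral_const, smul_eq_mul, hlen]))
  exact (PiLp.norm_apply_le (haarTruncVec N ξ.2 ((k : ℝ) / 2 ^ N) - ξ.2 s) i).trans
    (norm_haarTruncVec_sub_le hξ.2 hk ⟨le_rfl, hle⟩ (Ico_subset_Icc_self hs))

theorem inputVariation_fst_le (hξ : ξ ∈ relaxedSpace U q) {s t : ℝ} (hs : 0 ≤ s) (hst : s ≤ t)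
    (ht : t ≤ 1) :
    variationUpTo ξ.1 t - variationUpTo ξ.1 s ≤ inputVariation ξ t - inputVariation ξ s := by
  have := variationUpTo_mono hξ.2.2.2 hs hst ht
  unfold inputVariation
  linarith

theorem inputVariation_snd_le (hξ : ξ ∈ relaxedSpace U q) {s t : ℝ} (hs : 0 ≤ s) (hst : s ≤ t)
    (ht : t ≤ 1) :
    variationUpTo ξ.2 t - variationUpTo ξ.2 s ≤ inputVariation ξ t - inputVariation ξ s := by
  have := variationUpTo_mono hξ.1.2.2 hs hst ht
  unfold inputVariation
  linarith

/-- The projection `ρ_N` changes the trajectory by `O(2⁻ᴺ)`. -/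
theorem Regular.exists_norm_trajectory_sub_le {n : ℕ} {f : VectorFields n m q} {L : ℝ}
    (hf : Regular f U L) (x₀ : Vec n) (hUb : Bornology.IsBounded U) (hUc : Convex ℝ U) :
    ∃ K : ℝ, 0 < K ∧ ∀ ξ ∈ relaxedSpace U q, ∀ N : ℕ, ∀ x y : ℝ → Vec n,
      IsTrajectory f x₀ ξ x → IsTrajectory f x₀ (rho N ξ) y →
        ∀ t ∈ Icc (0 : ℝ) 1, ‖y t - x t‖ ≤ K * (1 / 2 ^ N) * (bvNorm ξ + 1) := by
  obtain ⟨C, hC0, hC⟩ := hf.exists_bound hUb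
  have hL := hf.pos
  set L' : ℝ := (q + 1) * L with hL'
  set C' : ℝ := (q + 1) * C with hC'
  have hL'0 : 0 < L' := by positivity
  -- `R` bounds the trajectories and `M` the velocities. Neither depends on `ξ` or `N`, which makes
  -- `K` uniform.
  set R : ℝ := (‖x₀‖ + C') * Real.exp L' with hR
  set M : ℝ := L' * R + C' with hM
  have hM0 : 0 ≤ M := by positivity
  -- The three summands come from the cell length, the variation and the incomplete cell; the
  -- exponential comes from Grönwall's inequality.
  refine ⟨(2 * L' * (1 + M) + (2 * L' + q * M) + 2 * M) * Real.exp L', by positivity,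
    fun ξ hξ N x y hx hy => ?_⟩
  have hp : (0 : ℝ) < 2 ^ N := by positivity
  have aξ := admissible_of_mem_relaxedSpace hξ
  have aζ := admissible_rho hUc hξ N
  have gξ := aξ.isCaratheodory hf hC0 hC
  have gζ := aζ.isCaratheodory hf hC0 hC
  have hxR : ∀ t ∈ Icc (0 : ℝ) 1, ‖x t‖ ≤ R := gξ.norm_solution_le hx.continuousOn hx.2
  have hLR : ∀ t ∈ Icc (0 : ℝ) 1, L' * ‖x t‖ + C' ≤ M := fun t ht => by
    rw [hM]
    gcongr
    exact hxR t ht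
  have hGξ : ∀ s ∈ Ico (0 : ℝ) 1, ‖relaxedField f s (x s) (ξ.1 s) (ξ.2 s)‖ ≤ M := fun s hs =>
    (gξ.norm_le hs (x s)).trans (hLR s (Ico_subset_Icc_self hs))
  have hGζ : ∀ s ∈ Ico (0 : ℝ) 1,
      ‖relaxedField f s (x s) ((rho N ξ).1 s) ((rho N ξ).2 s)‖ ≤ M := fun s hs =>
    (gζ.norm_le hs (x s)).trans (hLR s (Ico_subset_Icc_self hs))
  have hfM : ∀ i, ∀ s ∈ Icc (0 : ℝ) 1, ‖f s (x s) (ξ.1 s) i‖ ≤ M := fun i s hs => by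
    have hu := hξ.1.1 s hs
    have h1 := hf.lipschitz i s hs s hs (x s) 0 _ hu _ hu
    simp only [sub_self, abs_zero, norm_zero, add_zero, zero_add, sub_zero] at h1
    have h2 := norm_sub_norm_le (f s (x s) (ξ.1 s) i) (f s 0 (ξ.1 s) i)
    have h3 : L * ‖x s‖ ≤ L' * ‖x s‖ := by
      gcongr
      rw [hL']
      nlinarith [(Nat.cast_nonneg q : (0 : ℝ) ≤ q)]
    have h4 : C ≤ C' := by
      rw [hC']
      nlinarith [(Nat.cast_nonneg q : (0 : ℝ) ≤ q)]
    linarith [hC i s hs _ hu, hLR s hs]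
  have iζ := gζ.integrableOn hx.continuousOn
  have iξ := gξ.integrableOn hx.continuousOn
  have hΨ := iζ.sub iξ
  have hV : ∀ s ∈ Icc (0 : ℝ) 1, inputVariation ξ s ≤ inputVariation ξ 1 := fun s hs =>
    add_le_add (variationUpTo_mono hξ.1.2.2 hs.1 hs.2 le_rfl)
      (variationUpTo_mono hξ.2.2.2 hs.1 hs.2 le_rfl)
  have key := norm_integral_le_of_dyadic (V := inputVariation ξ) (B := 2 * M)
    (a := 2 * L' * (1 + M)) (b := 2 * L' + q * M) hΨ (by positivity) (by positivity)
    (fun s hs => (norm_sub_le _ _).trans (by linarith [hGξ s hs, hGζ s hs])) hV N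
    (fun k hk => by
      have m1 := dyadic_mem hk.le
      have m2 := dyadic_mem (k := N) (j := k + 1) hk
      push_cast at m2
      have hlt : (k : ℝ) / 2 ^ N < (k + 1) / 2 ^ N := by gcongr; linarith
      have hlen : ((k : ℝ) + 1) / 2 ^ N - k / 2 ^ N = 1 / 2 ^ N := by ring
      have v1 := inputVariation_fst_le hξ m1.1 hlt.le m2.2
      have v2 := inputVariation_snd_le hξ m1.1 hlt.le m2.2
      have h := hf.norm_integral_relaxedField_sub_le aξ aζ (M := M) m1.1 hlt m2.2 hΨ
        (fun i => hfM i _ m1)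
        (fun s hs => (hx.norm_sub_le hGξ m1.1 hs.1 (hs.2.le.trans m2.2)).trans (by
          gcongr
          exact hs.2.le))
        (fun s hs => (norm_sub_le_variation_of_mem hξ.1.2.2 m1.1 m2.2
          (Ico_subset_Icc_self hs) ⟨le_rfl, hlt.le⟩).trans v1)
        (fun s hs => (norm_haarTruncVec_sub_le hξ.1 hk hs ⟨le_rfl, hlt.le⟩).trans v1)
        (fun i => (abs_integral_pwm_sub_le hξ hk i).trans (by
          rw [hlen]
          gcongr))
      rw [hlen] at h
      exact h)
  intro t ht
  refine (gζ.norm_sub_le (a := 1 / 2 ^ N * (2 * L' * (1 + M) +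
    (2 * L' + q * M) * (inputVariation ξ 1 - inputVariation ξ 0) + 2 * M)) hx.continuousOn
    hy.continuousOn (fun t ht => ?_) t ht).trans ?_
  · have h0 : (0 : ℝ) ∈ Icc (0 : ℝ) 1 := ⟨le_rfl, zero_le_one⟩
    -- Both inputs are compared along the single curve `x`; the passage from `x` to `y` under the
    -- projected input is left to Grönwall's inequality.
    have e : y t - x t - ∫ s in (0 : ℝ)..t,
        (relaxedField f s (y s) ((rho N ξ).1 s) ((rho N ξ).2 s) -
          relaxedField f s (x s) ((rho N ξ).1 s) ((rho N ξ).2 s)) =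
        ∫ s in (0 : ℝ)..t, (relaxedField f s (x s) ((rho N ξ).1 s) ((rho N ξ).2 s) -
          relaxedField f s (x s) (ξ.1 s) (ξ.2 s)) := by
      rw [intervalIntegral.integral_sub
          (intervalIntegrable_of_integrableOn_Icc (gζ.integrableOn hy.continuousOn) h0 ht)
          (intervalIntegrable_of_integrableOn_Icc iζ h0 ht),
        intervalIntegral.integral_sub (intervalIntegrable_of_integrableOn_Icc iζ h0 ht)
          (intervalIntegrable_of_integrableOn_Icc iξ h0 ht), hy.2 t ht, hx.2 t ht]
      abel
    rw [e]
    exact key t ht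
  · have e0 : inputVariation ξ 0 = 0 := by
      simp [inputVariation, variationUpTo_zero]
    have hbv : 0 ≤ bvNorm ξ := ENNReal.toReal_nonneg
    rw [e0, sub_zero, inputVariation_one hξ]
    have h1 : 2 * L' * (1 + M) + (2 * L' + q * M) * bvNorm ξ + 2 * M ≤
        (2 * L' * (1 + M) + (2 * L' + q * M) + 2 * M) * (bvNorm ξ + 1) := by
      have a1 : 0 ≤ 2 * L' * (1 + M) * bvNorm ξ := by positivity
      have a2 : 0 ≤ 2 * M * bvNorm ξ := by positivity
      have a3 : 0 ≤ 2 * L' + q * M := by positivity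
      linarith
    calc _ ≤ 1 / 2 ^ N * ((2 * L' * (1 + M) + (2 * L' + q * M) + 2 * M) * (bvNorm ξ + 1)) *
          Real.exp L' := by gcongr
      _ = _ := by ring

end

end SwitchedSystem

theorem mainTheorem1 {n m q : ℕ} (f : VectorFields n m q) (x₀ : Vec n)
    (U : Set (Vec m)) (hUb : Bornology.IsBounded U) (hUc : Convex ℝ U)
    (L : ℝ) (hf : Regular f U L) :
    ∃ K : ℝ, 0 < K ∧ ∀ ξ ∈ relaxedSpace U q,
      HasUniqueTrajectory f x₀ ξ ∧
      ∀ N : ℕ, HasUniqueTrajectory f x₀ (rho N ξ) ∧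
        ∀ t ∈ Set.Icc (0 : ℝ) 1,
          ‖flow f x₀ t (rho N ξ) - flow f x₀ t ξ‖ ≤
            K * (1 / Real.sqrt 2) ^ N * (bvNorm ξ + 1) := by
  obtain ⟨K, hK, h⟩ := hf.exists_norm_trajectory_sub_le x₀ hUb hUc
  refine ⟨K, hK, fun ξ hξ => ?_⟩
  have h1 := (admissible_of_mem_relaxedSpace hξ).hasUniqueTrajectory hf hUb x₀
  refine ⟨h1, fun N => ?_⟩
  have h2 := (admissible_rho hUc hξ N).hasUniqueTrajectory hf hUb x₀
  refine ⟨h2, fun t ht => ?_⟩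
  refine (h ξ hξ N _ _ h1.isTrajectory_flow h2.isTrajectory_flow t ht).trans ?_
  have hbv : 0 ≤ bvNorm ξ := ENNReal.toReal_nonneg
  -- The rate `2⁻ᴺ` is weakened to the stated one through `√2 ≤ 2`.
  have hs : (1 : ℝ) / 2 ≤ 1 / Real.sqrt 2 :=
    one_div_le_one_div_of_le (by positivity)
      (Real.sqrt_le_iff.2 ⟨by norm_num, by norm_num⟩)
  have : (1 : ℝ) / 2 ^ N ≤ (1 / Real.sqrt 2) ^ N := by
    rw [← one_div_pow]
    gcongr
  gcongr
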